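/- Let $G$ be a locally compact (Hausdorff) abelian group with dual group $\hat G$, let $\mathcal{A}$ be a C*-algebra and let $\alpha: G\to \mathrm{Aut}(\mathcal{A})$ be a group homomorphism (no continuity of $\alpha$ is assumed; such a triple $(\mathcal{A},G,\alpha)$ is called a C*-action). A covariant representation of $(\mathcal{A},G,\alpha)$ on a Hilbert space $\mathcal{H}$ is a pair $(\pi,U)$ of a non-degenerate representation $\pi$ of $\mathcal{A}$ on $\mathcal{H}$ and a strongly continuous unitary representation $U$ of $G$ on $\mathcal{H}$ with $U(g)\pi(A)U(g)^*=\pi(\alpha_g(A))$ for all $g \in G$, $A\in\mathcal{A}$. Let $\mathcal{L}=C^*(G)$ with the canonical homomorphism $\eta:G\to UM(\mathcal{L})$, and for a strongly continuous unitary representation $U$ of $G$ let $U_{\mathcal{L}}$ be the corresponding non-degenerate representation of $\mathcal{L}$. A full crossed product host for $(\mathcal{A},G,\alpha)$ is a triple $(\mathcal{C},\eta_{\mathcal{A}},\eta_{\mathcal{L}})$ of a C*-algebra $\mathcal{C}$ and $*$-homomorphisms $\eta_{\mathcal{A}}:\mathcal{A}\to M(\mathcal{C})$, $\eta_{\mathcal{L}}:\mathcal{L}\to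 M(\mathcal{C})$ such that 1. $\eta_{\mathcal{L}}(\mathcal{L})\mathcal{C}$ spans a dense subspace of $\mathcal{C}$; 2. the extension $\tilde\eta_{\mathcal{L}}:M(\mathcal{L})\to M(\mathcal{C})$ of $\eta_{\mathcal{L}}$ satisfies $\tilde\eta_{\mathcal{L}}(\eta(g))\,\eta_{\mathcal{A}}(A)\,\tilde\eta_{\mathcal{L}}(\eta(g))^*=\eta_{\mathcal{A}}(\alpha_g(A))$ for all $A\in\mathcal{A}$, $g\in G$; 3. $\eta_{\mathcal{A}}(\mathcal{A})\eta_{\mathcal{L}}(\mathcal{L})\subseteq\mathcal{C}$, and $\mathcal{C}$ is generated by this set as a C*-algebra; 4. for every covariant representation $(\pi,U)$ of $(\mathcal{A},G,\alpha)$ on a Hilbert space $\mathcal{H}$ there is a unique representation $\rho:\mathcal{C}\to B(\mathcal{H})$ with $\rho(\eta_{\mathcal{A}}(A)\eta_{\mathcal{L}}(L))=\pi(A)U_{\mathcal{L}}(L)$ for all $A\in\mathcal{A}$, $L\in\mathcal{L}$. Let $\mathcal{A}\rtimes_\iota\hat G$ be the full crossed product of $\mathcal{A}$ by the trivial action $\iota$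 of $\hat G$, and let $\beta$ be the action of $G$ on $\mathcal{A}\rtimes_\iota\hat G$ determined by $(\beta_g f)(\gamma)=\langle g,\gamma\rangle\,\alpha_g(f(\gamma))$ for $f\in C_c(\hat G,\mathcal{A})$, $g\in G$, $\gamma\in\hat G$. Corollary. If the C*-action $(\mathcal{A},G,\alpha)$ has a full crossed product host, then so does the C*-action $(\mathcal{A}\rtimes_\iota\hat G,G,\beta)$. -/

import Mathlib

open scoped CompactlySupported MultiplierAlgebra ENNReal

universe u v w

noncomputable section

namespace CStarAction

/-! ### Non-degenerate representations and covariant representations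

A C*-action is a triple `(A, G, α)` with `A` a C*-algebra, `G` a locally compact group and
`α : G →* (A ≃⋆ₐ[ℂ] A)` a group homomorphism, with no continuity assumption. -/

/-- A representation `π` of `A` on `H` is non-degenerate if `π(A)H` spans a dense subspace. -/
def IsNondegenerateRep {A : Type*} [NonUnitalCStarAlgebra A]
    {H : Type*} [NormedAddCommGroup H] [InnerProductSpace ℂ H] [CompleteSpace H]
    (π : A →⋆ₙₐ[ℂ] (H →L[ℂ] H)) : Prop :=
  Dense (Submodule.span ℂ {x : H | ∃ (a : A) (ξ : H), π a ξ = x} : Set H)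

/-- A covariant representation of `(A, G, α)` on `H`: a non-degenerate representation `π` of `A` and
a strongly continuous unitary representation `U` of `G` with `U(g) π(a) U(g)* = π(α_g(a))`. -/
structure CovariantRep {G : Type*} [Group G] [TopologicalSpace G]
    {A : Type*} [NonUnitalCStarAlgebra A] (α : G →* (A ≃⋆ₐ[ℂ] A))
    (H : Type*) [NormedAddCommGroup H] [InnerProductSpace ℂ H] [CompleteSpace H] where
  π : A →⋆ₙₐ[ℂ] (H →L[ℂ] H)
  U : G →* unitary (H →L[ℂ] H)
  nondegenerate : IsNondegenerateRep π
  continuous_U : ∀ ξ : H, Continuous fun g => (U g : H →L[ℂ] H) ξ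
  covariant : ∀ (g : G) (a : A),
    (U g : H →L[ℂ] H) * π a * star (U g : H →L[ℂ] H) = π (α g a)

/-! ### The full crossed product -/

section CrossedProduct

/-- A left Haar measure on the Borel σ-algebra of a locally compact group. -/
def haarMeasure (G : Type*) [Group G] [TopologicalSpace G] [IsTopologicalGroup G]
    [LocallyCompactSpace G] : @MeasureTheory.Measure G (borel G) :=
  letI : MeasurableSpace G := borel G
  haveI : BorelSpace G := ⟨rfl⟩
  MeasureTheory.Measure.haar

variable {G : Type u} [Group G] [TopologicalSpace G] [IsTopologicalGroup G] [LocallyCompactSpace G]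
  {A : Type v} [NonUnitalCStarAlgebra A] {α : G →* (A ≃⋆ₐ[ℂ] A)}

namespace CovariantRep

variable {H : Type w} [NormedAddCommGroup H] [InnerProductSpace ℂ H] [CompleteSpace H]

theorem continuous_integrand (R : CovariantRep α H) (f : C_c(G, A)) (ξ : H) :
    Continuous fun s => R.π (f s) ((R.U s : H →L[ℂ] H) ξ) := by
  have h : Continuous R.π := (NonUnitalStarAlgHom.instContinuousLinearMapClassComplex
    (F := A →⋆ₙₐ[ℂ] (H →L[ℂ] H))).map_continuous R.π
  exact (h.comp f.continuous).clm_apply (R.continuous_U ξ)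

theorem integrable_integrand (R : CovariantRep α H) (f : C_c(G, A)) (ξ : H) :
    MeasureTheory.Integrable (fun s => R.π (f s) ((R.U s : H →L[ℂ] H) ξ)) (haarMeasure G) := by
  let _ : MeasurableSpace G := borel G
  have _ : BorelSpace G := ⟨rfl⟩
  refine Continuous.integrable_of_hasCompactSupport (μ := MeasureTheory.Measure.haar)
    (R.continuous_integrand f ξ) ?_
  refine f.hasCompactSupport.mono fun s hs hf => hs ?_
  simp [hf]

theorem integrable_norm (f : C_c(G, A)) :
    MeasureTheory.Integrable (fun s => ‖f s‖) (haarMeasure G) := by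
  let _ : MeasurableSpace G := borel G
  have _ : BorelSpace G := ⟨rfl⟩
  exact (Continuous.integrable_of_hasCompactSupport (μ := MeasureTheory.Measure.haar)
    f.continuous f.hasCompactSupport).norm

theorem norm_integral_le (R : CovariantRep α H) (f : C_c(G, A)) (ξ : H) :
    ‖∫ s, R.π (f s) ((R.U s : H →L[ℂ] H) ξ) ∂(haarMeasure G)‖
      ≤ (∫ s, ‖f s‖ ∂(haarMeasure G)) * ‖ξ‖ := by
  rw [← MeasureTheory.integral_mul_const]
  refine MeasureTheory.norm_integral_le_of_norm_le ((integrable_norm f).mul_const _)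
    (Filter.Eventually.of_forall fun s => ?_)
  refine (ContinuousLinearMap.le_opNorm _ _).trans ?_
  rw [Unitary.norm_map]
  gcongr
  exact NonUnitalStarAlgHom.norm_apply_le R.π (f s)

/-- The integrated form `(π ⋊ U)(f) = ∫ π(f(s)) U(s) ds` of a covariant representation, for
`f ∈ C_c(G, A)`; the integral is taken in the strong sense, on each vector. -/
def integratedForm (R : CovariantRep α H) (f : C_c(G, A)) : H →L[ℂ] H :=
  LinearMap.mkContinuous
    { toFun := fun ξ => ∫ s, R.π (f s) ((R.U s : H →L[ℂ] H) ξ) ∂(haarMeasure G)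
      map_add' := fun ξ η => by
        simp only [map_add]
        exact MeasureTheory.integral_add (R.integrable_integrand f ξ) (R.integrable_integrand f η)
      map_smul' := fun c ξ => by
        simp only [map_smul, RingHom.id_apply]
        exact MeasureTheory.integral_smul c _ }
    (∫ s, ‖f s‖ ∂(haarMeasure G)) (R.norm_integral_le f)

theorem integratedForm_apply (R : CovariantRep α H) (f : C_c(G, A)) (ξ : H) :
    R.integratedForm f ξ = ∫ s, R.π (f s) ((R.U s : H →L[ℂ] H) ξ) ∂(haarMeasure G) := rfl

theorem norm_integratedForm_le (R : CovariantRep α H) (f : C_c(G, A)) :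
    ‖R.integratedForm f‖ ≤ ∫ s, ‖f s‖ ∂(haarMeasure G) :=
  LinearMap.mkContinuous_norm_le _ (MeasureTheory.integral_nonneg fun _ => norm_nonneg _) _

end CovariantRep

/-- Bundled complex Hilbert spaces. -/
structure HilbertSpace : Type (w + 1) where
  carrier : Type w
  [normedAddCommGroup : NormedAddCommGroup carrier]
  [innerProductSpace : InnerProductSpace ℂ carrier]
  [completeSpace : CompleteSpace carrier]

attribute [instance] HilbertSpace.normedAddCommGroup HilbertSpace.innerProductSpace
  HilbertSpace.completeSpace

variable (α)

/-- The set of all functions `f ↦ ‖(π ⋊ U)(f)‖` on `C_c(G, A)`, where `(π, U)` runs through all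
covariant representations on all Hilbert spaces. -/
def integratedNorms : Set (C_c(G, A) → ℝ) :=
  {n | ∃ (H : HilbertSpace.{max u v}) (R : CovariantRep α H.carrier),
    n = fun f => ‖R.integratedForm f‖}

/-- A Hilbert space carrying a covariant representation with the given norm function. -/
def normSpace (n : integratedNorms α) : HilbertSpace.{max u v} :=
  n.2.choose

/-- A (small) index set: all covariant representations of `(A, G, α)` on the spaces `normSpace n`.
By construction every covariant representation on any Hilbert space has the same norm function
`f ↦ ‖(π ⋊ U)(f)‖` as a member of this family, so that the supremum of these norms over the family
is the supremum over all covariant representations. -/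
abbrev RepIndex : Type (max u v) :=
  Σ n : integratedNorms α, CovariantRep α (normSpace α n).carrier

/-- The C*-algebra of operators on the Hilbert space of a member of the family. -/
abbrev RepOp (j : RepIndex α) : Type (max u v) :=
  (normSpace α j.1).carrier →L[ℂ] (normSpace α j.1).carrier

/-- The C*-algebra `ℓ^∞`-product of all `B(H_j)`, `j = (H_j, π_j, U_j)` in the family. -/
def UniversalProduct : Type (max u v) := lp (RepOp α) ∞

instance : NonUnitalCStarAlgebra (UniversalProduct α) :=
  inferInstanceAs (NonUnitalCStarAlgebra (lp (RepOp α) ∞))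

variable {α}

/-- The component of `x` at a member of the family. -/
def UniversalProduct.comp (x : UniversalProduct α) (j : RepIndex α) : RepOp α j := x.1 j

/-- A bounded family of operators as an element of the `ℓ^∞`-product. -/
def UniversalProduct.mk (x : ∀ j, RepOp α j) (C : ℝ) (hx : ∀ j, ‖x j‖ ≤ C) :
    UniversalProduct α :=
  ⟨x, memℓp_infty ⟨C, by rintro _ ⟨j, rfl⟩; exact hx j⟩⟩

namespace UniversalProduct

theorem ext {x y : UniversalProduct α} (h : ∀ j, x.comp j = y.comp j) : x = y :=
  Subtype.ext (funext h)

theorem comp_mk (x : ∀ j, RepOp α j) (C : ℝ) (hx : ∀ j, ‖x j‖ ≤ C) (j : RepIndex α) :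
    (mk x C hx).comp j = x j := rfl

theorem comp_mul (x y : UniversalProduct α) (j : RepIndex α) :
    (x * y).comp j = x.comp j * y.comp j := rfl

theorem comp_add (x y : UniversalProduct α) (j : RepIndex α) :
    (x + y).comp j = x.comp j + y.comp j := rfl

theorem comp_zero (j : RepIndex α) : (0 : UniversalProduct α).comp j = 0 := rfl

theorem comp_smul (c : ℂ) (x : UniversalProduct α) (j : RepIndex α) :
    (c • x).comp j = c • x.comp j := rfl

theorem comp_star (x : UniversalProduct α) (j : RepIndex α) :
    (star x).comp j = star (x.comp j) := rfl

theorem norm_comp_le (x : UniversalProduct α) (j : RepIndex α) : ‖x.comp j‖ ≤ ‖x‖ :=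
  lp.norm_apply_le_norm (p := ∞) (by simp) (show lp (RepOp α) ∞ from x) j

end UniversalProduct

/-- The universal integrated form of `f ∈ C_c(G, A)`: the bounded family of all `(π ⋊ U)(f)`. -/
def universalForm (f : C_c(G, A)) : UniversalProduct α :=
  UniversalProduct.mk (fun j => j.2.integratedForm f) (∫ s, ‖f s‖ ∂(haarMeasure G))
    fun j => j.2.norm_integratedForm_le f

variable (α)

/-- The full crossed product `A ⋊_α G` as a C*-subalgebra of the `ℓ^∞`-product: the C*-algebra
generated by the universal integrated forms of `f ∈ C_c(G, A)`. As each `π ⋊ U` is multiplicative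
and involutive for the convolution and the involution of `C_c(G, A)`, this is the completion of
`C_c(G, A)` in the universal norm `‖f‖ = sup ‖(π ⋊ U)(f)‖`. It is the crossed product
when `α` is continuous, in particular when `α` is trivial. -/
def crossedProductSubalgebra : NonUnitalStarSubalgebra ℂ (UniversalProduct α) :=
  (NonUnitalStarAlgebra.adjoin ℂ
    (Set.range (universalForm : C_c(G, A) → UniversalProduct α))).topologicalClosure

/-- The full crossed product `A ⋊_α G`. -/
def CrossedProduct : Type (max u v) := crossedProductSubalgebra α

instance : NonUnitalCStarAlgebra (CrossedProduct α) :=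
  @NonUnitalStarSubalgebra.nonUnitalCStarAlgebra _ _ _ _ _ _ _ (crossedProductSubalgebra α)
    (NonUnitalStarSubalgebra.isClosed_topologicalClosure _)

variable {α}

namespace CrossedProduct

theorem universalForm_mem (f : C_c(G, A)) :
    universalForm f ∈ crossedProductSubalgebra α :=
  NonUnitalStarSubalgebra.le_topologicalClosure _
    (NonUnitalStarAlgebra.subset_adjoin ℂ _ ⟨f, rfl⟩)

/-- The canonical map `C_c(G, A) → A ⋊_α G`. -/
def of (f : C_c(G, A)) : CrossedProduct α :=
  ⟨universalForm f, universalForm_mem f⟩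

/-- The norm of `A ⋊_α G` dominates every covariant representation. -/
theorem norm_integratedForm_le_norm_of {H : Type max u v} [NormedAddCommGroup H]
    [InnerProductSpace ℂ H] [CompleteSpace H] (R : CovariantRep α H) (f : C_c(G, A)) :
    ‖R.integratedForm f‖ ≤ ‖(of f : CrossedProduct α)‖ := by
  let n : integratedNorms α := ⟨fun f => ‖R.integratedForm f‖, ⟨H⟩, R, rfl⟩
  obtain ⟨S, hS⟩ := n.2.choose_spec
  have h : ‖R.integratedForm f‖ = ‖S.integratedForm f‖ := congrFun hS f
  rw [h]
  exact UniversalProduct.norm_comp_le (universalForm f) (⟨n, S⟩ : RepIndex α)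

end CrossedProduct

end CrossedProduct

/-! ### Trivial actions of locally compact abelian groups -/

section Trivial

variable {K : Type u} [CommGroup K] [TopologicalSpace K] [IsTopologicalGroup K]
  [LocallyCompactSpace K] {A : Type v} [NonUnitalCStarAlgebra A]

/-- The translate `(λ_s f)(k) = f(s⁻¹ k)`. -/
def translate (s : K) (f : C_c(K, A)) : C_c(K, A) where
  toFun k := f (s⁻¹ * k)
  continuous_toFun := f.continuous.comp (continuous_const.mul continuous_id)
  hasCompactSupport' := f.hasCompactSupport.comp_homeomorph (Homeomorph.mulLeft s⁻¹)

theorem translate_apply (s : K) (f : C_c(K, A)) (k : K) : translate s f k = f (s⁻¹ * k) := rfl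

/-- The function `k ↦ χ(k) φ(f(k))`, for a character `χ` of `K` and an automorphism `φ` of `A`. -/
def twistFun (χ : PontryaginDual K) (φ : A ≃⋆ₐ[ℂ] A) (f : C_c(K, A)) : C_c(K, A) where
  toFun k := (χ k : ℂ) • φ (f k)
  continuous_toFun := by
    have h1 : Continuous fun k => (χ k : ℂ) := continuous_subtype_val.comp (map_continuous χ)
    exact h1.smul ((StarAlgEquiv.isometry φ).continuous.comp f.continuous)
  hasCompactSupport' := by
    refine f.hasCompactSupport.mono fun s hs hf => hs ?_
    simp [hf]

/-- The trivial action of `K` on `A`. -/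
abbrev trivialAction (K : Type u) [CommGroup K] (A : Type v) [NonUnitalCStarAlgebra A] :
    K →* (A ≃⋆ₐ[ℂ] A) := 1

theorem CovariantRep.U_mul_π {H : Type w} [NormedAddCommGroup H] [InnerProductSpace ℂ H]
    [CompleteSpace H] (R : CovariantRep (trivialAction K A) H) (s : K) (a : A) :
    (R.U s : H →L[ℂ] H) * R.π a = R.π a * (R.U s : H →L[ℂ] H) := by
  have h := R.covariant s a
  simp only [MonoidHom.one_apply, StarAlgEquiv.one_apply] at h
  calc (R.U s : H →L[ℂ] H) * R.π a
      = (R.U s : H →L[ℂ] H) * R.π a * (star (R.U s : H →L[ℂ] H) * (R.U s : H →L[ℂ] H)) := by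
        rw [Unitary.coe_star_mul_self, mul_one]
    _ = R.π a * (R.U s : H →L[ℂ] H) := by rw [← mul_assoc, h]

theorem CovariantRep.U_mul_integratedForm {H : Type w} [NormedAddCommGroup H]
    [InnerProductSpace ℂ H] [CompleteSpace H] (R : CovariantRep (trivialAction K A) H)
    (s : K) (f : C_c(K, A)) :
    (R.U s : H →L[ℂ] H) * R.integratedForm f = R.integratedForm (translate s f) := by
  let _ : MeasurableSpace K := borel K
  have _ : BorelSpace K := ⟨rfl⟩
  ext ξ
  refine Eq.trans (ContinuousLinearMap.integral_comp_comm (R.U s : H →L[ℂ] H)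
    (R.integrable_integrand f ξ)).symm ?_
  have h := MeasureTheory.integral_mul_left_eq_self (μ := MeasureTheory.Measure.haar)
    (fun k => R.π (translate s f k) ((R.U k : H →L[ℂ] H) ξ)) s
  refine Eq.trans ?_ h
  refine MeasureTheory.integral_congr_ae (Filter.Eventually.of_forall fun k => ?_)
  have h2 := congrArg (fun T : H →L[ℂ] H => T ((R.U k : H →L[ℂ] H) ξ)) (R.U_mul_π s (f k))
  simp only [mul_apply_eq_comp] at h2
  beta_reduce
  rw [translate_apply, inv_mul_cancel_left, map_mul, h2]
  rfl

theorem CovariantRep.integratedForm_mul_U {H : Type w} [NormedAddCommGroup H]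
    [InnerProductSpace ℂ H] [CompleteSpace H] (R : CovariantRep (trivialAction K A) H)
    (s : K) (f : C_c(K, A)) :
    R.integratedForm f * (R.U s : H →L[ℂ] H) = R.integratedForm (translate s f) := by
  rw [← R.U_mul_integratedForm]
  let _ : MeasurableSpace K := borel K
  have _ : BorelSpace K := ⟨rfl⟩
  ext ξ
  refine Eq.trans ?_ (ContinuousLinearMap.integral_comp_comm (R.U s : H →L[ℂ] H)
    (R.integrable_integrand f ξ))
  refine MeasureTheory.integral_congr_ae (Filter.Eventually.of_forall fun k => ?_)
  have h2 := congrArg (fun T : H →L[ℂ] H => T ((R.U k : H →L[ℂ] H) ξ)) (R.U_mul_π s (f k))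
  have h3 : (R.U k : H →L[ℂ] H) ((R.U s : H →L[ℂ] H) ξ)
      = (R.U s : H →L[ℂ] H) ((R.U k : H →L[ℂ] H) ξ) := by
    have h4 : R.U k * R.U s = R.U s * R.U k := by rw [← map_mul, ← map_mul, mul_comm]
    exact congrArg (fun V : unitary (H →L[ℂ] H) => (V : H →L[ℂ] H) ξ) h4
  simp only [mul_apply_eq_comp] at h2
  exact (congrArg (R.π (f k)) h3).trans h2.symm

variable (A) in
/-- The bounded family of all `U(s)`, for the members `(π, U)` of the universal family. -/
def universalUnitary (s : K) : UniversalProduct (trivialAction K A) :=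
  UniversalProduct.mk (fun j => (j.2.U s : RepOp (trivialAction K A) j)) 1 fun j => by
    refine ContinuousLinearMap.opNorm_le_bound _ zero_le_one fun ξ => ?_
    rw [Unitary.norm_map, one_mul]

theorem universalUnitary_mul (s t : K) :
    universalUnitary A (s * t) = universalUnitary A s * universalUnitary A t := by
  refine UniversalProduct.ext fun j => ?_
  change (j.2.U (s * t) : RepOp (trivialAction K A) j) = j.2.U s * j.2.U t
  rw [map_mul]; rfl

theorem universalUnitary_one_mul (x : UniversalProduct (trivialAction K A)) :
    universalUnitary A (1 : K) * x = x := by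
  refine UniversalProduct.ext fun j => ?_
  change (j.2.U 1 : RepOp (trivialAction K A) j) * x.comp j = x.comp j
  rw [map_one]; exact one_mul _

theorem universalUnitary_mul_one (x : UniversalProduct (trivialAction K A)) :
    x * universalUnitary A (1 : K) = x := by
  refine UniversalProduct.ext fun j => ?_
  change x.comp j * (j.2.U 1 : RepOp (trivialAction K A) j) = x.comp j
  rw [map_one]; exact mul_one _

theorem star_universalUnitary (s : K) :
    star (universalUnitary A s) = universalUnitary A s⁻¹ := by
  refine UniversalProduct.ext fun j => ?_
  change star (j.2.U s : RepOp (trivialAction K A) j) = j.2.U s⁻¹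
  rw [map_inv]; rfl

theorem universalUnitary_mul_mem_and {x : UniversalProduct (trivialAction K A)}
    (hx : x ∈ crossedProductSubalgebra (trivialAction K A)) :
    ∀ s : K, universalUnitary A s * x ∈ crossedProductSubalgebra (trivialAction K A) ∧
      x * universalUnitary A s ∈ crossedProductSubalgebra (trivialAction K A) := by
  have key : ∀ y ∈ NonUnitalStarAlgebra.adjoin ℂ
      (Set.range (universalForm : C_c(K, A) → UniversalProduct (trivialAction K A))),
      ∀ s : K, universalUnitary A s * y ∈ crossedProductSubalgebra (trivialAction K A) ∧
        y * universalUnitary A s ∈ crossedProductSubalgebra (trivialAction K A) := by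
    intro y hy
    have hle := NonUnitalStarSubalgebra.le_topologicalClosure (NonUnitalStarAlgebra.adjoin ℂ
      (Set.range (universalForm : C_c(K, A) → UniversalProduct (trivialAction K A))))
    induction hy using NonUnitalStarAlgebra.adjoin_induction with
    | mem y hy =>
      obtain ⟨f, rfl⟩ := hy
      intro s
      have h1 : universalUnitary A s * universalForm f = universalForm (translate s f) := by
        refine UniversalProduct.ext fun j => ?_
        exact j.2.U_mul_integratedForm s f
      have h2 : universalForm f * universalUnitary A s = universalForm (translate s f) := by
        refine UniversalProduct.ext fun j => ?_
        exact j.2.integratedForm_mul_U s f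
      rw [h1, h2]
      exact ⟨CrossedProduct.universalForm_mem _, CrossedProduct.universalForm_mem _⟩
    | add y z _ _ ihy ihz =>
      intro s
      rw [mul_add, add_mul]
      exact ⟨add_mem (ihy s).1 (ihz s).1, add_mem (ihy s).2 (ihz s).2⟩
    | zero => intro s; simp [zero_mem]
    | mul y z hy hz ihy ihz =>
      intro s
      rw [← mul_assoc, mul_assoc y]
      exact ⟨mul_mem (ihy s).1 (hle hz), mul_mem (hle hy) (ihz s).2⟩
    | smul c y _ ihy =>
      intro s
      rw [mul_smul_comm, smul_mul_assoc]
      exact ⟨SMulMemClass.smul_mem c (ihy s).1, SMulMemClass.smul_mem c (ihy s).2⟩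
    | star y _ ihy =>
      intro s
      have h := ihy s⁻¹
      have h1 := star_mem h.1
      have h2 := star_mem h.2
      rw [star_mul, star_universalUnitary, inv_inv] at h1 h2
      exact ⟨h2, h1⟩
  intro s
  have hx' : x ∈ closure (NonUnitalStarAlgebra.adjoin ℂ (Set.range
    (universalForm : C_c(K, A) → UniversalProduct (trivialAction K A))) :
      Set (UniversalProduct (trivialAction K A))) := hx
  have hcl : IsClosed (crossedProductSubalgebra (trivialAction K A) :
      Set (UniversalProduct (trivialAction K A))) :=
    NonUnitalStarSubalgebra.isClosed_topologicalClosure _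
  constructor
  · have h := map_mem_closure (f := fun y => universalUnitary A s * y)
      (t := (crossedProductSubalgebra (trivialAction K A) :
        Set (UniversalProduct (trivialAction K A))))
      (continuous_const.mul continuous_id) hx' fun y hy => (key y hy s).1
    rwa [hcl.closure_eq] at h
  · have h := map_mem_closure (f := fun y => y * universalUnitary A s)
      (t := (crossedProductSubalgebra (trivialAction K A) :
        Set (UniversalProduct (trivialAction K A))))
      (continuous_id.mul continuous_const) hx' fun y hy => (key y hy s).2
    rwa [hcl.closure_eq] at h

/-- The multiplier of `A ⋊ K` (trivial action) given by `s ∈ K`: left and right multiplication by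
the family of all `U(s)`. On `C_c(K, A)` it is the translation `f ↦ f(s⁻¹ ·)`. -/
def translationMultiplier (s : K) : 𝓜(ℂ, CrossedProduct (trivialAction K A)) where
  fst := LinearMap.mkContinuous
    { toFun := fun x => ⟨universalUnitary A s * x.1, (universalUnitary_mul_mem_and x.2 s).1⟩
      map_add' := fun x y => Subtype.ext (mul_add _ _ _)
      map_smul' := fun c x => Subtype.ext (mul_smul_comm c _ x.1) }
    ‖universalUnitary A s‖ (fun x => norm_mul_le (universalUnitary A s) x.1)
  snd := LinearMap.mkContinuous
    { toFun := fun x => ⟨x.1 * universalUnitary A s, (universalUnitary_mul_mem_and x.2 s).2⟩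
      map_add' := fun x y => Subtype.ext (add_mul _ _ _)
      map_smul' := fun c x => Subtype.ext (smul_mul_assoc c x.1 _) }
    ‖universalUnitary A s‖ (fun x => (norm_mul_le x.1 (universalUnitary A s)).trans_eq (mul_comm _ _))
  central := fun x y => Subtype.ext (mul_assoc _ _ _)

theorem translationMultiplier_fst_coe (s : K) (x : CrossedProduct (trivialAction K A)) :
    ((translationMultiplier s).fst x).1 = universalUnitary A s * x.1 := rfl

theorem translationMultiplier_snd_coe (s : K) (x : CrossedProduct (trivialAction K A)) :
    ((translationMultiplier s).snd x).1 = x.1 * universalUnitary A s := rfl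

theorem translationMultiplier_mul (s t : K) :
    (translationMultiplier (s * t) : 𝓜(ℂ, CrossedProduct (trivialAction K A))) =
      translationMultiplier s * translationMultiplier t := by
  refine DoubleCentralizer.ext _ _ _ _ (Prod.ext ?_ ?_) <;>
    refine ContinuousLinearMap.ext fun x => Subtype.ext ?_
  · change universalUnitary A (s * t) * x.1 = universalUnitary A s * (universalUnitary A t * x.1)
    rw [universalUnitary_mul, mul_assoc]
  · change x.1 * universalUnitary A (s * t) = x.1 * universalUnitary A s * universalUnitary A t
    rw [universalUnitary_mul, mul_assoc]

theorem translationMultiplier_one :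
    (translationMultiplier (1 : K) : 𝓜(ℂ, CrossedProduct (trivialAction K A))) = 1 := by
  refine DoubleCentralizer.ext _ _ _ _ (Prod.ext ?_ ?_) <;>
    refine ContinuousLinearMap.ext fun x => Subtype.ext ?_
  · exact universalUnitary_one_mul x.1
  · exact universalUnitary_mul_one x.1

theorem star_translationMultiplier (s : K) :
    star (translationMultiplier s : 𝓜(ℂ, CrossedProduct (trivialAction K A))) =
      translationMultiplier s⁻¹ := by
  refine DoubleCentralizer.ext _ _ _ _ (Prod.ext ?_ ?_) <;>
    refine ContinuousLinearMap.ext fun x => Subtype.ext ?_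
  · change star (star x.1 * universalUnitary A s) = universalUnitary A s⁻¹ * x.1
    rw [star_mul, star_star, star_universalUnitary]
  · change star (universalUnitary A s * star x.1) = x.1 * universalUnitary A s⁻¹
    rw [star_mul, star_star, star_universalUnitary]

variable (K A) in
/-- The canonical homomorphism `K → UM(A ⋊ K)`, for the trivial action of `K` on `A`. -/
def canonicalUnitary : K →* unitary 𝓜(ℂ, CrossedProduct (trivialAction K A)) where
  toFun s := ⟨translationMultiplier s, by
    rw [Unitary.mem_iff, star_translationMultiplier, ← translationMultiplier_mul,
      ← translationMultiplier_mul, inv_mul_cancel, mul_inv_cancel, translationMultiplier_one]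
    exact ⟨rfl, rfl⟩⟩
  map_one' := Subtype.ext translationMultiplier_one
  map_mul' s t := Subtype.ext (translationMultiplier_mul s t)

/-- The group C*-algebra `C*(K)`, as the crossed product `ℂ ⋊ K`. A covariant representation of
`(ℂ, K, trivial)` is a strongly continuous unitary representation `U` of `K` together with the
representation `z ↦ z1` of `ℂ`, so that `C*(K)` is the completion of `C_c(K)` in the norm
`sup_U ‖∫ f(k) U(k) dk‖`. -/
abbrev GroupCStarAlgebra (K : Type u) [CommGroup K] [TopologicalSpace K] [IsTopologicalGroup K]
    [LocallyCompactSpace K] : Type u :=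
  CrossedProduct (trivialAction K ℂ)

/-- The canonical homomorphism `η : K → UM(C*(K))`. -/
abbrev groupUnitary (K : Type u) [CommGroup K] [TopologicalSpace K] [IsTopologicalGroup K]
    [LocallyCompactSpace K] : K →* unitary 𝓜(ℂ, GroupCStarAlgebra K) :=
  canonicalUnitary K ℂ

/-- The covariant representation `(π ∘ φ, χ U)` of the trivial action, for an automorphism `φ` of
`A` and a character `χ` of `K`. -/
def CovariantRep.twist {H : Type w} [NormedAddCommGroup H] [InnerProductSpace ℂ H]
    [CompleteSpace H] (χ : PontryaginDual K) (φ : A ≃⋆ₐ[ℂ] A)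
    (R : CovariantRep (trivialAction K A) H) : CovariantRep (trivialAction K A) H where
  π := R.π.comp (φ : A →⋆ₙₐ[ℂ] A)
  U :=
    { toFun := fun k => ⟨(χ k : ℂ) • (R.U k : H →L[ℂ] H), by
        have h : star (χ k : ℂ) * (χ k : ℂ) = 1 := by
          rw [Complex.star_def, mul_comm, Complex.mul_conj, Circle.normSq_coe, Complex.ofReal_one]
        rw [Unitary.mem_iff, star_smul, smul_mul_smul_comm, smul_mul_smul_comm,
          Unitary.star_mul_self_of_mem (R.U k).2, Unitary.mul_star_self_of_mem (R.U k).2,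
          mul_comm (χ k : ℂ), h, one_smul]
        exact ⟨rfl, rfl⟩⟩
      map_one' := Subtype.ext (by simp)
      map_mul' := fun k l => Subtype.ext (by
        simp [smul_smul, mul_comm]) }
  nondegenerate := by
    have h : {x : H | ∃ (a : A) (ξ : H), (R.π.comp (φ : A →⋆ₙₐ[ℂ] A)) a ξ = x}
        = {x : H | ∃ (a : A) (ξ : H), R.π a ξ = x} := by
      ext x
      constructor
      · rintro ⟨a, ξ, rfl⟩
        exact ⟨φ a, ξ, rfl⟩
      · rintro ⟨a, ξ, rfl⟩
        exact ⟨φ.symm a, ξ, congrArg (fun b => R.π b ξ) (φ.apply_symm_apply a)⟩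
    rw [IsNondegenerateRep, h]
    exact R.nondegenerate
  continuous_U := fun ξ => by
    have h1 : Continuous fun k => (χ k : ℂ) := continuous_subtype_val.comp (map_continuous χ)
    exact h1.smul (R.continuous_U ξ)
  covariant := fun k a => by
    have h : star (χ k : ℂ) * (χ k : ℂ) = 1 := by
      rw [Complex.star_def, mul_comm, Complex.mul_conj, Circle.normSq_coe, Complex.ofReal_one]
    change ((χ k : ℂ) • (R.U k : H →L[ℂ] H)) * R.π (φ a) *
      star ((χ k : ℂ) • (R.U k : H →L[ℂ] H)) = R.π (φ a)
    rw [star_smul, smul_mul_assoc, smul_mul_smul_comm, mul_comm (χ k : ℂ), h, one_smul]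
    exact R.covariant k (φ a)

theorem CovariantRep.twist_integratedForm {H : Type w} [NormedAddCommGroup H]
    [InnerProductSpace ℂ H] [CompleteSpace H] (χ : PontryaginDual K) (φ : A ≃⋆ₐ[ℂ] A)
    (R : CovariantRep (trivialAction K A) H) (f : C_c(K, A)) :
    (R.twist χ φ).integratedForm f = R.integratedForm (twistFun χ φ f) := by
  let _ : MeasurableSpace K := borel K
  ext ξ
  rw [CovariantRep.integratedForm_apply, CovariantRep.integratedForm_apply]
  refine MeasureTheory.integral_congr_ae (Filter.Eventually.of_forall fun k => ?_)
  change R.π (φ (f k)) (((χ k : ℂ) • (R.U k : H →L[ℂ] H)) ξ) =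
    R.π ((χ k : ℂ) • φ (f k)) ((R.U k : H →L[ℂ] H) ξ)
  rw [map_smul R.π, smul_apply, smul_apply, map_smul]

theorem CovariantRep.twist_twist {H : Type w} [NormedAddCommGroup H] [InnerProductSpace ℂ H]
    [CompleteSpace H] (χ χ' : PontryaginDual K) (φ φ' : A ≃⋆ₐ[ℂ] A)
    (R : CovariantRep (trivialAction K A) H) :
    (R.twist χ φ).twist χ' φ' = R.twist (χ * χ') (φ * φ') := by
  have h : ((R.twist χ φ).twist χ' φ').U = (R.twist (χ * χ') (φ * φ')).U := by
    refine MonoidHom.ext fun k => Subtype.ext ?_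
    change (χ' k : ℂ) • (χ k : ℂ) • (R.U k : H →L[ℂ] H) =
      (((χ * χ') k : Circle) : ℂ) • (R.U k : H →L[ℂ] H)
    have h2 : (χ * χ') k = χ k * χ' k := rfl
    rw [smul_smul, h2, Circle.coe_mul, mul_comm]
  change CovariantRep.mk _ _ _ _ _ = CovariantRep.mk _ _ _ _ _
  congr 1

theorem CovariantRep.twist_one {H : Type w} [NormedAddCommGroup H] [InnerProductSpace ℂ H]
    [CompleteSpace H] (R : CovariantRep (trivialAction K A) H) : R.twist 1 1 = R := by
  have h : (R.twist 1 1).U = R.U := by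
    refine MonoidHom.ext fun k => Subtype.ext ?_
    exact one_smul ℂ _
  cases R
  change CovariantRep.mk _ _ _ _ _ = CovariantRep.mk _ _ _ _ _
  congr 1

/-- The operation on families of operators induced by `(π, U) ↦ (π ∘ φ, χ U)`. -/
def twistProduct (χ : PontryaginDual K) (φ : A ≃⋆ₐ[ℂ] A) :
    UniversalProduct (trivialAction K A) →⋆ₙₐ[ℂ] UniversalProduct (trivialAction K A) where
  toFun x := UniversalProduct.mk (fun j => x.comp ⟨j.1, j.2.twist χ φ⟩) ‖x‖
    fun j => x.norm_comp_le ⟨j.1, j.2.twist χ φ⟩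
  map_smul' _ _ := rfl
  map_zero' := rfl
  map_add' _ _ := rfl
  map_mul' _ _ := rfl
  map_star' _ := rfl

theorem twistProduct_comp_apply (χ : PontryaginDual K) (φ : A ≃⋆ₐ[ℂ] A)
    (x : UniversalProduct (trivialAction K A)) (j : RepIndex (trivialAction K A)) :
    (twistProduct χ φ x).comp j = x.comp ⟨j.1, j.2.twist χ φ⟩ := rfl

theorem twistProduct_universalForm (χ : PontryaginDual K) (φ : A ≃⋆ₐ[ℂ] A) (f : C_c(K, A)) :
    twistProduct χ φ (universalForm f) = universalForm (twistFun χ φ f) :=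
  UniversalProduct.ext fun j => j.2.twist_integratedForm χ φ f

theorem twistProduct_mul (χ χ' : PontryaginDual K) (φ φ' : A ≃⋆ₐ[ℂ] A)
    (x : UniversalProduct (trivialAction K A)) :
    twistProduct (χ * χ') (φ * φ') x = twistProduct χ φ (twistProduct χ' φ' x) :=
  UniversalProduct.ext fun j => by
    rw [twistProduct_comp_apply, twistProduct_comp_apply, twistProduct_comp_apply,
      CovariantRep.twist_twist]

theorem twistProduct_one (x : UniversalProduct (trivialAction K A)) :
    twistProduct (1 : PontryaginDual K) 1 x = x :=
  UniversalProduct.ext fun j => by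
    rw [twistProduct_comp_apply, CovariantRep.twist_one]

theorem twistProduct_mem (χ : PontryaginDual K) (φ : A ≃⋆ₐ[ℂ] A)
    {x : UniversalProduct (trivialAction K A)}
    (hx : x ∈ crossedProductSubalgebra (trivialAction K A)) :
    twistProduct χ φ x ∈ crossedProductSubalgebra (trivialAction K A) := by
  have hx' : x ∈ closure (NonUnitalStarAlgebra.adjoin ℂ (Set.range
    (universalForm : C_c(K, A) → UniversalProduct (trivialAction K A))) :
      Set (UniversalProduct (trivialAction K A))) := hx
  have hc : Continuous (twistProduct (A := A) χ φ) :=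
    (NonUnitalStarAlgHom.instContinuousLinearMapClassComplex
      (F := UniversalProduct (trivialAction K A) →⋆ₙₐ[ℂ]
        UniversalProduct (trivialAction K A))).map_continuous _
  refine map_mem_closure hc hx' fun y hy => ?_
  have h : NonUnitalStarAlgebra.adjoin ℂ (Set.range
      (universalForm : C_c(K, A) → UniversalProduct (trivialAction K A))) ≤
      (NonUnitalStarAlgebra.adjoin ℂ (Set.range
        (universalForm : C_c(K, A) → UniversalProduct (trivialAction K A)))).comap
          (twistProduct χ φ) := by
    refine NonUnitalStarAlgebra.adjoin_le ?_
    rintro _ ⟨f, rfl⟩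
    change twistProduct χ φ (universalForm f) ∈ NonUnitalStarAlgebra.adjoin ℂ (Set.range
      (universalForm : C_c(K, A) → UniversalProduct (trivialAction K A)))
    rw [twistProduct_universalForm]
    exact NonUnitalStarAlgebra.subset_adjoin ℂ _ ⟨_, rfl⟩
  exact h hy

/-- The automorphism of `A ⋊ K` (trivial action) extending `f ↦ (k ↦ χ(k) φ(f(k)))` on
`C_c(K, A)`. -/
def twistAut (χ : PontryaginDual K) (φ : A ≃⋆ₐ[ℂ] A) :
    CrossedProduct (trivialAction K A) ≃⋆ₐ[ℂ] CrossedProduct (trivialAction K A) where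
  toFun x := ⟨twistProduct χ φ x.1, twistProduct_mem χ φ x.2⟩
  invFun x := ⟨twistProduct χ⁻¹ φ⁻¹ x.1, twistProduct_mem χ⁻¹ φ⁻¹ x.2⟩
  left_inv x := Subtype.ext (by
    change twistProduct χ⁻¹ φ⁻¹ (twistProduct χ φ x.1) = x.1
    rw [← twistProduct_mul, inv_mul_cancel, inv_mul_cancel, twistProduct_one])
  right_inv x := Subtype.ext (by
    change twistProduct χ φ (twistProduct χ⁻¹ φ⁻¹ x.1) = x.1
    rw [← twistProduct_mul, mul_inv_cancel, mul_inv_cancel, twistProduct_one])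
  map_mul' x y := Subtype.ext (map_mul (twistProduct χ φ) x.1 y.1)
  map_add' x y := Subtype.ext (map_add (twistProduct χ φ) x.1 y.1)
  map_star' x := Subtype.ext (map_star (twistProduct χ φ) x.1)
  map_smul' c x := Subtype.ext (map_smul (twistProduct χ φ) c x.1)

theorem twistAut_of (χ : PontryaginDual K) (φ : A ≃⋆ₐ[ℂ] A) (f : C_c(K, A)) :
    twistAut χ φ (CrossedProduct.of f) = CrossedProduct.of (twistFun χ φ f) :=
  Subtype.ext (twistProduct_universalForm χ φ f)

end Trivial

/-! ### The action `β` of `G` on `A ⋊_ι Ĝ` -/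

section Dual

variable {G : Type u} [CommGroup G] [TopologicalSpace G] [IsTopologicalGroup G]
  [LocallyCompactSpace G] {A : Type v} [NonUnitalCStarAlgebra A]

/-- The character `γ ↦ ⟨g, γ⟩ = γ(g)` of the dual group. -/
def evalCharacter (g : G) : PontryaginDual (PontryaginDual G) :=
  (⟨⟨⟨fun γ => γ g, rfl⟩, fun _ _ => rfl⟩,
    ContinuousEvalConst.continuous_eval_const (F := G →ₜ* Circle) g⟩ :
      PontryaginDual G →ₜ* Circle)

theorem evalCharacter_apply (g : G) (γ : PontryaginDual G) : evalCharacter g γ = γ g := rfl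

/-- The crossed product `A ⋊_ι Ĝ` by the trivial action `ι` of the dual group. -/
abbrev DualCrossedProduct (G : Type u) [CommGroup G] [TopologicalSpace G] [IsTopologicalGroup G]
    [LocallyCompactSpace G] (A : Type v) [NonUnitalCStarAlgebra A] : Type (max u v) :=
  CrossedProduct (trivialAction (PontryaginDual G) A)

/-- The action `β` of `G` on `A ⋊_ι Ĝ`; on `C_c(Ĝ, A)` it is
`(β_g f)(γ) = ⟨g, γ⟩ α_g(f(γ))`. -/
def dualAction (α : G →* (A ≃⋆ₐ[ℂ] A)) :
    G →* (DualCrossedProduct G A ≃⋆ₐ[ℂ] DualCrossedProduct G A) where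
  toFun g := twistAut (evalCharacter g) (α g)
  map_one' := by
    have h : evalCharacter (1 : G) = 1 := PontryaginDual.ext fun γ => map_one γ
    refine StarAlgEquiv.ext fun x => Subtype.ext ?_
    change twistProduct (evalCharacter (1 : G)) (α 1) x.1 = x.1
    rw [h, map_one, twistProduct_one]
  map_mul' g g' := by
    have h : evalCharacter (g * g') = evalCharacter g * evalCharacter g' :=
      PontryaginDual.ext fun γ => map_mul γ g g'
    refine StarAlgEquiv.ext fun x => Subtype.ext ?_
    change twistProduct (evalCharacter (g * g')) (α (g * g')) x.1 =
      twistProduct (evalCharacter g) (α g) (twistProduct (evalCharacter g') (α g') x.1)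
    rw [h, map_mul, twistProduct_mul]

theorem dualAction_of (α : G →* (A ≃⋆ₐ[ℂ] A)) (g : G) (f : C_c(PontryaginDual G, A)) :
    ∃ f' : C_c(PontryaginDual G, A), (∀ γ, f' γ = (γ g : ℂ) • α g (f γ)) ∧
      dualAction α g (CrossedProduct.of f) = CrossedProduct.of f' :=
  ⟨twistFun (evalCharacter g) (α g) f, fun _ => rfl, twistAut_of _ _ f⟩

end Dual

/-! ### Crossed product hosts -/

section Host

/-- For a homomorphism `φ` of `L` into a unital C*-algebra `E` (`E = B(H)` or `E = M(C)`), which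
is non-degenerate, this says that `b` is the value `φ̃(m)` at the multiplier `m` of the unique
extension `φ̃ : M(L) → E` of `φ`: it is the element with `φ̃(m) φ(l) = φ(m l)` for all `l`. -/
def IsExtensionValue {L E : Type*} [NonUnitalCStarAlgebra L] [CStarAlgebra E]
    (φ : L →⋆ₙₐ[ℂ] E) (m : 𝓜(ℂ, L)) (b : E) : Prop :=
  ∀ l : L, b * φ l = φ (m.fst l)

/-- A full crossed product host `(C, η_A, η_L)` for `(α, L)`, where `(A, G, α)` is a C*-action and
`(L, η)` is a host algebra for `G`. Covariant representations are taken on Hilbert spaces in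
`Type w`. -/
structure IsFullCrossedProductHost {G : Type*} [Group G] [TopologicalSpace G]
    {A : Type*} [NonUnitalCStarAlgebra A] (α : G →* (A ≃⋆ₐ[ℂ] A))
    {L : Type*} [NonUnitalCStarAlgebra L] (η : G →* unitary 𝓜(ℂ, L))
    {C : Type*} [NonUnitalCStarAlgebra C]
    (ηA : A →⋆ₙₐ[ℂ] 𝓜(ℂ, C)) (ηL : L →⋆ₙₐ[ℂ] 𝓜(ℂ, C)) : Prop where
  /-- `η_L` is non-degenerate: `η_L(L)C` is dense in `C`. -/
  nondegenerate :
    Dense (Submodule.span ℂ {c : C | ∃ (l : L) (d : C), (ηL l).fst d = c} : Set C)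
  /-- `η̃_L(η(g)) η_A(a) η̃_L(η(g))* = η_A(α_g(a))`. -/
  covariant : ∀ g : G, ∃ b : 𝓜(ℂ, C), IsExtensionValue ηL (η g : 𝓜(ℂ, L)) b ∧
    ∀ a : A, b * ηA a * star b = ηA (α g a)
  /-- `η_A(A) η_L(L) ⊆ C`. -/
  mul_mem : ∀ (a : A) (l : L), ∃ c : C, (c : 𝓜(ℂ, C)) = ηA a * ηL l
  /-- `C` is generated by `η_A(A) η_L(L)` as a C*-algebra. -/
  generates : (NonUnitalStarAlgebra.adjoin ℂ
    {c : C | ∃ (a : A) (l : L), (c : 𝓜(ℂ, C)) = ηA a * ηL l}).topologicalClosure = ⊤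
  /-- For every covariant representation `(π, U)` such that `U` is an `L`-representation, i.e. there
  is a non-degenerate representation `T = U_L` of `L` with `T̃ ∘ η = U`, there is a unique
  representation `ρ` of `C` with `ρ(η_A(a) η_L(l)) = π(a) U_L(l)`. -/
  full : ∀ (H : Type w) [NormedAddCommGroup H] [InnerProductSpace ℂ H] [CompleteSpace H]
    (R : CovariantRep α H) (T : L →⋆ₙₐ[ℂ] (H →L[ℂ] H)), IsNondegenerateRep T →
    (∀ g : G, IsExtensionValue T (η g : 𝓜(ℂ, L)) (R.U g : H →L[ℂ] H)) →
    ∃! ρ : C →⋆ₙₐ[ℂ] (H →L[ℂ] H), ∀ (a : A) (l : L) (c : C),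
      (c : 𝓜(ℂ, C)) = ηA a * ηL l → ρ c = R.π a * T l

/-- The C*-action `(A, G, α)`, with `G` locally compact abelian, has a full crossed product host
for `(α, C*(G))`. -/
def HasFullCrossedProductHost {G : Type u} [CommGroup G] [TopologicalSpace G]
    [IsTopologicalGroup G] [LocallyCompactSpace G] {A : Type v} [NonUnitalCStarAlgebra A]
    (α : G →* (A ≃⋆ₐ[ℂ] A)) : Prop :=
  ∃ (C : Type (max u v)) (_ : NonUnitalCStarAlgebra C)
    (ηA : A →⋆ₙₐ[ℂ] 𝓜(ℂ, C)) (ηL : GroupCStarAlgebra G →⋆ₙₐ[ℂ] 𝓜(ℂ, C)),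
    IsFullCrossedProductHost.{max u v} α (groupUnitary G) ηA ηL

end Host

end CStarAction

end

noncomputable section

namespace CStarAction

open Filter Topology

/-! ### C*-algebraic generalities: multipliers, extensions of representations, homomorphisms from
norm estimates. -/

section Generalities

/-! A host exists as soon as $T(e)\pi(a)T(l)\to\pi(a)T(l)$ in norm, uniformly over all covariant
representations $(\pi,U)$ with $T=U_{\mathcal L}$, when $e$ runs through a contractive approximate
unit of $\mathcal L$ (`Host.isFullCrossedProductHost`). The candidate is the C*-algebra generated by
all $\pi(a)T(l)$ in a universal product of covariant representations. Everything except
non-degeneracy of $\eta_{\mathcal L}$ holds for it without further assumption, and the convergence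
supplies exactly that. The universal property rests on `exists_hom_of_norm_lift_le`: a set of
representatives, one for each norm function on noncommutative polynomials in $\mathcal
A\sqcup\mathcal L$, dominates every covariant representation.

To verify the convergence for $\beta$, let $(\pi,U)$ be a covariant representation of $(\mathcal
A\rtimes_\iota\hat G,G,\beta)$. Extending $\pi$ to multipliers splits it into a representation
$\pi_A$ of $\mathcal A$ and a commuting unitary representation $V$ of $\hat G$
(`IsNondegenerateRep.covariantRep`). Since $\beta_g$ acts as $\alpha_g$ on $\mathcal A$ and
multiplies $\gamma\in\hat G$ by $\gamma(g)$, the pair $(\pi_A,U)$ is covariant for $\alpha$ and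
$U_gV_\gamma=\gamma(g)V_\gamma U_g$. Hence $V_\gamma T(f)=T(\gamma^{-1}f)V_\gamma$ for $f\in
C_c(G)$, and for $\varphi\in C_c(\hat G,\mathcal A)$
$$\pi(\varphi)T(f)=\int\pi_A(\varphi(\gamma))\,T(\gamma^{-1}f)\,V_\gamma\,d\gamma=\int\sigma(c(\gamma))\,V_\gamma\,d\gamma,$$
where $c(\gamma)=\eta_{\mathcal A}(\varphi(\gamma))\eta_{\mathcal L}(\gamma^{-1}f)$ lies in the
given host $\mathcal C$ of $\alpha$ and $\sigma$ is the representation of $\mathcal C$ belonging to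
$(\pi_A,U)$. The function $c$ is continuous, compactly supported and independent of $(\pi,U)$. As
$\eta_{\mathcal L}(e)\to1$ strictly on $\mathcal C$, the convergence $\eta_{\mathcal
L}(e)c(\gamma)\to c(\gamma)$ is uniform in $\gamma$, which gives the uniform estimate
`eventually_norm_T_mul_sub_le`. Density arguments then pass from $\varphi$ and $f$ to arbitrary
elements (`tendsto_T_mul_π_mul_T`). -/

theorem continuous_starHom {D E : Type*} [NonUnitalCStarAlgebra D] [NonUnitalCStarAlgebra E]
    (φ : D →⋆ₙₐ[ℂ] E) : Continuous φ :=
  (NonUnitalStarAlgHom.instContinuousLinearMapClassComplex (F := D →⋆ₙₐ[ℂ] E)).map_continuous φ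

/-- Every C*-algebra has a contractive two-sided approximate unit. -/
theorem exists_approximateUnit (L : Type*) [NonUnitalCStarAlgebra L] :
    ∃ l : Filter L, l.IsApproximateUnit ∧ ∀ᶠ e in l, ‖e‖ ≤ 1 := by
  let _ := CStarAlgebra.spectralOrder L
  let _ := CStarAlgebra.spectralOrderedRing L
  exact ⟨CStarAlgebra.approximateUnit L,
    (CStarAlgebra.increasingApproximateUnit L).toIsApproximateUnit,
    (CStarAlgebra.increasingApproximateUnit L).eventually_norm⟩

variable {D : Type*} [NonUnitalCStarAlgebra D]

theorem eq_of_forall_mul_left {x y : D} (h : ∀ z, z * x = z * y) : x = y := by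
  rw [← sub_eq_zero, ← CStarRing.star_mul_self_eq_zero_iff, mul_sub, h, sub_self]

theorem eq_of_forall_mul_right {x y : D} (h : ∀ z, x * z = y * z) : x = y := by
  rw [← sub_eq_zero, ← CStarRing.mul_star_self_eq_zero_iff, sub_mul, h, sub_self]

theorem multiplier_fst_mul (m : 𝓜(ℂ, D)) (x y : D) : m.fst (x * y) = m.fst x * y :=
  eq_of_forall_mul_left fun z => by
    rw [← m.central, ← mul_assoc, m.central, mul_assoc]

/-- Centrality recovers the right action from the left one, because an element of a C*-algebra is
determined by its products with all others. Multiplier identities below are therefore checked on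
`fst` only. -/
theorem multiplier_ext_fst {m n : 𝓜(ℂ, D)} (h : ∀ x, m.fst x = n.fst x) : m = n := by
  refine DoubleCentralizer.ext _ _ _ _ (Prod.ext (ContinuousLinearMap.ext h)
    (ContinuousLinearMap.ext fun x => eq_of_forall_mul_right fun y => ?_))
  rw [m.central, n.central, h]

theorem continuous_multiplier_fst : Continuous fun m : 𝓜(ℂ, D) => m.fst := by
  refine Isometry.continuous (Isometry.of_dist_eq fun m n => ?_)
  rw [dist_eq_norm, dist_eq_norm, ← DoubleCentralizer.norm_fst (m - n)]
  rfl

theorem coe_multiplier_injective {x y : D} (h : (x : 𝓜(ℂ, D)) = (y : 𝓜(ℂ, D))) : x = y :=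
  eq_of_forall_mul_right fun z => congrArg (fun m : 𝓜(ℂ, D) => m.fst z) h

theorem isometry_coe_multiplier : Isometry (fun x : D => (x : 𝓜(ℂ, D))) :=
  NonUnitalStarAlgHom.isometry (DoubleCentralizer.coeHom (𝕜 := ℂ) (A := D))
    fun _ _ h => coe_multiplier_injective h

theorem coe_fst_apply (m : 𝓜(ℂ, D)) (x : D) : ((m.fst x : D) : 𝓜(ℂ, D)) = m * (x : 𝓜(ℂ, D)) :=
  multiplier_ext_fst fun y => (multiplier_fst_mul m x y).symm

/-- An element of `M` acting by multiplication on the image of an isometric homomorphism `ι : D → M`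
defines a multiplier of `D`. -/
def multiplierOfMul {M : Type*} [NonUnitalCStarAlgebra M] (ι : D →⋆ₙₐ[ℂ] M)
    (hι : Function.Injective ι) (m : M) (hl : ∀ x, ∃ y, ι y = m * ι x)
    (hr : ∀ x, ∃ y, ι y = ι x * m) : 𝓜(ℂ, D) where
  fst := LinearMap.mkContinuous
    { toFun := fun x => (hl x).choose
      map_add' := fun x y => hι (by
        refine (hl (x + y)).choose_spec.trans ?_
        rw [map_add, map_add, (hl x).choose_spec, (hl y).choose_spec, mul_add])
      map_smul' := fun c x => hι (by
        refine (hl (c • x)).choose_spec.trans ?_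
        rw [RingHom.id_apply, map_smul, map_smul, (hl x).choose_spec, mul_smul_comm]) }
    ‖m‖ (fun x => by
      rw [← NonUnitalStarAlgHom.norm_map ι hι, ← NonUnitalStarAlgHom.norm_map ι hι x]
      exact ((congrArg norm (hl x).choose_spec).trans_le (norm_mul_le _ _)))
  snd := LinearMap.mkContinuous
    { toFun := fun x => (hr x).choose
      map_add' := fun x y => hι (by
        refine (hr (x + y)).choose_spec.trans ?_
        rw [map_add, map_add, (hr x).choose_spec, (hr y).choose_spec, add_mul])
      map_smul' := fun c x => hι (by
        refine (hr (c • x)).choose_spec.trans ?_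
        rw [RingHom.id_apply, map_smul, map_smul, (hr x).choose_spec, smul_mul_assoc]) }
    ‖m‖ (fun x => by
      rw [← NonUnitalStarAlgHom.norm_map ι hι, ← NonUnitalStarAlgHom.norm_map ι hι x, mul_comm]
      exact ((congrArg norm (hr x).choose_spec).trans_le (norm_mul_le _ _)))
  central x y := hι (by
    change ι ((hr x).choose * y) = ι (x * (hl y).choose)
    rw [map_mul, map_mul, (hr _).choose_spec, (hl _).choose_spec, mul_assoc])

section MultiplierOfMul

variable {M : Type*} [NonUnitalCStarAlgebra M] (ι : D →⋆ₙₐ[ℂ] M) (hι : Function.Injective ι)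

theorem multiplierOfMul_fst (m : M) (hl : ∀ x, ∃ y, ι y = m * ι x)
    (hr : ∀ x, ∃ y, ι y = ι x * m) (x : D) :
    ι ((multiplierOfMul ι hι m hl hr).fst x) = m * ι x := (hl x).choose_spec

theorem multiplierOfMul_snd (m : M) (hl : ∀ x, ∃ y, ι y = m * ι x)
    (hr : ∀ x, ∃ y, ι y = ι x * m) (x : D) :
    ι ((multiplierOfMul ι hι m hl hr).snd x) = ι x * m := (hr x).choose_spec

theorem exists_mul_of_star {m : M} (hl : ∀ x, ∃ y, ι y = star m * ι x) (x : D) :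
    ∃ y, ι y = ι x * m := by
  obtain ⟨y, hy⟩ := hl (star x)
  exact ⟨star y, by rw [map_star, hy, star_mul, map_star, star_star, star_star]⟩

/-- A homomorphism into `M` whose range multiplies the image of `ι : D → M` into itself defines a
homomorphism into the multiplier algebra of `D`. -/
def multiplierHom {E : Type*} [NonUnitalCStarAlgebra E] (φ : E →⋆ₙₐ[ℂ] M)
    (hφ : ∀ e x, ∃ y, ι y = φ e * ι x) : E →⋆ₙₐ[ℂ] 𝓜(ℂ, D) where
  toFun e := multiplierOfMul ι hι (φ e) (hφ e)
    (exists_mul_of_star ι fun x => by rw [← map_star]; exact hφ _ x)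
  map_smul' c e := multiplier_ext_fst fun x => hι (by
    refine (multiplierOfMul_fst ..).trans (Eq.symm ?_)
    refine (map_smul ι c _).trans ((congrArg (c • ·) (multiplierOfMul_fst ..)).trans ?_)
    rw [map_smul, smul_mul_assoc])
  map_zero' := multiplier_ext_fst fun x => hι (by
    refine (multiplierOfMul_fst ..).trans (Eq.symm ((map_zero ι).trans ?_))
    rw [map_zero, zero_mul])
  map_add' e e' := multiplier_ext_fst fun x => hι (by
    refine (multiplierOfMul_fst ..).trans (Eq.symm ((map_add ι _ _).trans ?_))
    refine (congrArg₂ (· + ·) (multiplierOfMul_fst ..) (multiplierOfMul_fst ..)).trans ?_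
    rw [map_add, add_mul])
  map_mul' e e' := multiplier_ext_fst fun x => hι (by
    refine (multiplierOfMul_fst ..).trans (Eq.symm ?_)
    refine (multiplierOfMul_fst ι hι (φ e) (hφ e) (exists_mul_of_star ι fun x => by
      rw [← map_star]; exact hφ _ x) _).trans ?_
    refine (congrArg (φ e * ·) (multiplierOfMul_fst ..)).trans ?_
    rw [map_mul, mul_assoc])
  map_star' e := multiplier_ext_fst fun x => hι (by
    rw [DoubleCentralizer.star_fst]
    refine (multiplierOfMul_fst ..).trans (Eq.symm ((map_star ι _).trans ?_))
    refine (congrArg star (multiplierOfMul_snd ..)).trans ?_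
    rw [star_mul, map_star, map_star, star_star])

theorem multiplierHom_fst {E : Type*} [NonUnitalCStarAlgebra E] (φ : E →⋆ₙₐ[ℂ] M)
    (hφ : ∀ e x, ∃ y, ι y = φ e * ι x) (e : E) (x : D) :
    ι ((multiplierHom ι hι φ hφ e).fst x) = φ e * ι x := multiplierOfMul_fst ι hι ..

end MultiplierOfMul

/-! ### Extending non-degenerate representations to multipliers -/

section Extension

variable {H : Type*} [NormedAddCommGroup H] [InnerProductSpace ℂ H] [CompleteSpace H]
  {ρ : D →⋆ₙₐ[ℂ] (H →L[ℂ] H)}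

/-- Two bounded operators that agree on `ρ(D)H` are equal. -/
theorem IsNondegenerateRep.ext (hρ : IsNondegenerateRep ρ) {E : Type*} [NormedAddCommGroup E]
    [NormedSpace ℂ E] {a b : H →L[ℂ] E} (h : ∀ d ξ, a (ρ d ξ) = b (ρ d ξ)) : a = b :=
  ContinuousLinearMap.ext_on hρ (by rintro _ ⟨d, ξ, rfl⟩; exact h d ξ)

theorem IsNondegenerateRep.ext_mul (hρ : IsNondegenerateRep ρ) {a b : H →L[ℂ] H}
    (h : ∀ d, a * ρ d = b * ρ d) : a = b :=
  hρ.ext fun d ξ => congrArg (fun t : H →L[ℂ] H => t ξ) (h d)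

theorem IsNondegenerateRep.ext_mul_left (hρ : IsNondegenerateRep ρ) {a b : H →L[ℂ] H}
    (h : ∀ d, ρ d * a = ρ d * b) : a = b :=
  star_injective (hρ.ext_mul fun d => by
    have := congrArg star (h (star d))
    rwa [star_mul, star_mul, map_star, star_star] at this)

/-- The prescription $\rho(d)\xi\mapsto\rho(md)\xi$ is well defined and bounded on the span of
$\rho(D)H$, because it is the pointwise limit of the operators $\rho(me)$, whose norms are at most
$\|m\|$, along a contractive approximate unit. -/
theorem IsNondegenerateRep.exists_isExtensionValue (hρ : IsNondegenerateRep ρ) (m : 𝓜(ℂ, D)) :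
    ∃ b : H →L[ℂ] H, IsExtensionValue ρ m b := by
  obtain ⟨l, hl, hl1⟩ := exists_approximateUnit D
  have := hl.neBot
  -- Formal combinations of pairs $(d,\xi)$ avoid choosing representatives in the span: the estimate
  -- $\|f x\|\le\|m\|\,\|p x\|$ contains well-definedness.
  let p : (D × H →₀ ℂ) →ₗ[ℂ] H := Finsupp.linearCombination ℂ fun q => ρ q.1 q.2
  let f : (D × H →₀ ℂ) →ₗ[ℂ] H := Finsupp.linearCombination ℂ fun q => ρ (m.fst q.1) q.2
  have hp : DenseRange p := by
    have h : Set.range p = (Submodule.span ℂ {x : H | ∃ (a : D) (ξ : H), ρ a ξ = x} : Set H) := by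
      rw [← LinearMap.coe_range, Finsupp.range_linearCombination]
      congr 2
      ext x
      simp
    rw [DenseRange, h]
    exact hρ
  have hlim : ∀ x, Tendsto (fun e => ρ (m.fst e) (p x)) l (𝓝 (f x)) := by
    intro x
    induction x using Finsupp.induction_linear with
    | zero => simp
    | add x y hx hy => simpa only [map_add] using hx.add hy
    | single q c =>
      have h1 : Tendsto (fun e => ρ (m.fst (e * q.1))) l (𝓝 (ρ (m.fst q.1))) :=
        ((continuous_starHom ρ).comp m.fst.continuous).continuousAt.tendsto.comp
          (hl.tendsto_mul_right q.1)
      have h2 := ((ContinuousLinearMap.apply ℂ H q.2).continuous.continuousAt.tendsto.comp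
        h1).const_smul c
      simpa [p, f, multiplier_fst_mul, Function.comp_def] using h2
  have hb : ∀ x, ‖f x‖ ≤ ‖m.fst‖ * ‖p x‖ := by
    intro x
    refine le_of_tendsto (hlim x).norm (hl1.mono fun e he => ?_)
    refine (ContinuousLinearMap.le_opNorm _ _).trans ?_
    gcongr
    exact (NonUnitalStarAlgHom.norm_apply_le ρ _).trans
      ((m.fst.le_opNorm e).trans (mul_le_of_le_one_right (norm_nonneg _) he))
  refine ⟨f.extendOfNorm p, fun d => ContinuousLinearMap.ext fun ξ => ?_⟩
  have h := LinearMap.extendOfNorm_eq hp ⟨_, hb⟩ (Finsupp.single (d, ξ) 1)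
  simpa [p, f] using h

/-- The extension of a non-degenerate representation to the multiplier algebra. -/
def IsNondegenerateRep.extension (hρ : IsNondegenerateRep ρ) :
    𝓜(ℂ, D) →⋆ₐ[ℂ] (H →L[ℂ] H) where
  toFun m := (hρ.exists_isExtensionValue m).choose
  map_one' := hρ.ext_mul fun d => by
    rw [(hρ.exists_isExtensionValue _).choose_spec, one_mul]; rfl
  map_mul' m n := hρ.ext_mul fun d => by
    rw [(hρ.exists_isExtensionValue _).choose_spec, mul_assoc,
      (hρ.exists_isExtensionValue _).choose_spec, (hρ.exists_isExtensionValue _).choose_spec]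
    rfl
  map_zero' := hρ.ext_mul fun d => by
    rw [(hρ.exists_isExtensionValue _).choose_spec, zero_mul]
    exact map_zero ρ
  map_add' m n := hρ.ext_mul fun d => by
    rw [(hρ.exists_isExtensionValue _).choose_spec, add_mul,
      (hρ.exists_isExtensionValue _).choose_spec, (hρ.exists_isExtensionValue _).choose_spec,
      ← map_add]
    rfl
  commutes' c := hρ.ext_mul fun d => by
    rw [(hρ.exists_isExtensionValue _).choose_spec, ← Algebra.smul_def, ← map_smul]
    rfl
  -- The adjoint of $\tilde\rho(m)$ is only known through products from the left by $\rho(d')$, so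
  -- both sides are compressed as $\rho(d')\,\cdot\,\rho(d)$ and centrality of the multiplier
  -- finishes.
  map_star' m := hρ.ext_mul fun d => hρ.ext_mul_left fun d' => by
    rw [(hρ.exists_isExtensionValue _).choose_spec, ← mul_assoc, ← star_star (ρ d'), ← star_mul,
      ← map_star ρ, (hρ.exists_isExtensionValue _).choose_spec, ← map_star ρ, ← map_star ρ,
      ← map_mul, ← map_mul, star_star, ← DoubleCentralizer.star_snd, (star m).central]

theorem IsNondegenerateRep.extension_mul (hρ : IsNondegenerateRep ρ) (m : 𝓜(ℂ, D)) (d : D) :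
    hρ.extension m * ρ d = ρ (m.fst d) :=
  (hρ.exists_isExtensionValue m).choose_spec d

theorem IsNondegenerateRep.extension_apply (hρ : IsNondegenerateRep ρ) (m : 𝓜(ℂ, D)) (d : D)
    (ξ : H) : hρ.extension m (ρ d ξ) = ρ (m.fst d) ξ :=
  congrArg (fun t : H →L[ℂ] H => t ξ) (hρ.extension_mul m d)

end Extension

/-! ### Homomorphisms determined by norm inequalities -/

section Graph

variable {M N X : Type*} [NonUnitalCStarAlgebra M] [NonUnitalCStarAlgebra N]

/-- The involution merely permutes the generators, so no adjoints are needed in the polynomials. The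
free algebra may be non-associative, since it serves only as a supply of formal polynomials. -/
theorem adjoin_eq_lift {x : X → M} {σ : X → X} (hx : ∀ i, star (x i) = x (σ i)) {m : M}
    (hm : m ∈ NonUnitalStarAlgebra.adjoin ℂ (Set.range x)) :
    ∃ p, FreeNonUnitalNonAssocAlgebra.lift ℂ x p = m := by
  have hm' : m ∈ NonUnitalAlgebra.adjoin ℂ (Set.range x ∪ star (Set.range x)) := hm
  clear hm
  induction hm' using NonUnitalAlgebra.adjoin_induction with
  | mem m hm =>
    rcases hm with ⟨i, rfl⟩ | ⟨i, hi⟩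
    · exact ⟨_, FreeNonUnitalNonAssocAlgebra.lift_of_apply ℂ x i⟩
    · refine ⟨_, (FreeNonUnitalNonAssocAlgebra.lift_of_apply ℂ x (σ i)).trans ?_⟩
      rw [← hx, hi, star_star]
  | add m n _ _ ihm ihn =>
    obtain ⟨p, rfl⟩ := ihm
    obtain ⟨q, rfl⟩ := ihn
    exact ⟨p + q, map_add _ _ _⟩
  | zero => exact ⟨0, map_zero _⟩
  | mul m n _ _ ihm ihn =>
    obtain ⟨p, rfl⟩ := ihm
    obtain ⟨q, rfl⟩ := ihn
    exact ⟨p * q, map_mul _ _ _⟩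
  | smul c m _ ihm =>
    obtain ⟨p, rfl⟩ := ihm
    exact ⟨c • p, map_smul _ _ _⟩

/-- If every noncommutative polynomial in the family `y` has norm at most that of the same
polynomial in the family `x`, then `x i ↦ y i` extends to a homomorphism of the C*-algebra generated
by `x`. -/
theorem exists_hom_of_norm_lift_le {x : X → M} {y : X → N} {σ : X → X}
    (hx : ∀ i, star (x i) = x (σ i)) (hy : ∀ i, star (y i) = y (σ i))
    (h : ∀ p, ‖FreeNonUnitalNonAssocAlgebra.lift ℂ y p‖ ≤
      ‖FreeNonUnitalNonAssocAlgebra.lift ℂ x p‖) :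
    ∃ φ : (NonUnitalStarAlgebra.adjoin ℂ (Set.range x)).topologicalClosure →⋆ₙₐ[ℂ] N,
      ∀ i (hi : x i ∈ (NonUnitalStarAlgebra.adjoin ℂ (Set.range x)).topologicalClosure),
        φ ⟨x i, hi⟩ = y i := by
  -- The homomorphism is constructed through its graph: the C*-subalgebra `E` of $M\times N$
  -- generated by the pairs $(x_i,y_i)$.
  let z : X → M × N := fun i => (x i, y i)
  let E := (NonUnitalStarAlgebra.adjoin ℂ (Set.range z)).topologicalClosure
  have hE : IsClosed (E : Set (M × N)) := NonUnitalStarSubalgebra.isClosed_topologicalClosure _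
  have hz : ∀ i, z i ∈ E := fun i => NonUnitalStarSubalgebra.le_topologicalClosure _
    (NonUnitalStarAlgebra.subset_adjoin ℂ _ ⟨i, rfl⟩)
  have hfst : ∀ p, (FreeNonUnitalNonAssocAlgebra.lift ℂ z p).1 =
      FreeNonUnitalNonAssocAlgebra.lift ℂ x p := by
    intro p
    have := FreeNonUnitalNonAssocAlgebra.hom_ext (R := ℂ)
      (F₁ := (NonUnitalAlgHom.fst ℂ M N).comp (FreeNonUnitalNonAssocAlgebra.lift ℂ z))
      (F₂ := FreeNonUnitalNonAssocAlgebra.lift ℂ x) (by intro i; simp [z])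
    exact DFunLike.congr_fun this p
  have hsnd : ∀ p, (FreeNonUnitalNonAssocAlgebra.lift ℂ z p).2 =
      FreeNonUnitalNonAssocAlgebra.lift ℂ y p := by
    intro p
    have := FreeNonUnitalNonAssocAlgebra.hom_ext (R := ℂ)
      (F₁ := (NonUnitalAlgHom.snd ℂ M N).comp (FreeNonUnitalNonAssocAlgebra.lift ℂ z))
      (F₂ := FreeNonUnitalNonAssocAlgebra.lift ℂ y) (by intro i; simp [z])
    exact DFunLike.congr_fun this p
  have hnorm : ∀ q ∈ E, ‖q.2‖ ≤ ‖q.1‖ := by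
    intro q hq
    refine closure_minimal (t := {q : M × N | ‖q.2‖ ≤ ‖q.1‖}) ?_
      (isClosed_le (by fun_prop) (by fun_prop)) hq
    intro q hq
    obtain ⟨p, rfl⟩ := adjoin_eq_lift (σ := σ) (fun i => Prod.ext (hx i) (hy i)) hq
    change ‖(FreeNonUnitalNonAssocAlgebra.lift ℂ z p).2‖ ≤
      ‖(FreeNonUnitalNonAssocAlgebra.lift ℂ z p).1‖
    rw [hfst, hsnd]
    exact h p
  -- By `hnorm` the first projection is isometric on the complete space `E`, for the maximum norm of
  -- the product. Its range is therefore closed, and it contains all polynomials in `x`.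
  have hex : ∀ m : (NonUnitalStarAlgebra.adjoin ℂ (Set.range x)).topologicalClosure,
      ∃ n, (m.1, n) ∈ E := by
    let π : E → M := fun q => q.1.1
    have hπ : Isometry π := by
      refine Isometry.of_dist_eq fun q r => ?_
      change dist q.1.1 r.1.1 = dist q.1 r.1
      rw [dist_eq_norm, dist_eq_norm, Prod.norm_def]
      exact (max_eq_left (hnorm (q.1 - r.1) (sub_mem q.2 r.2))).symm
    have : CompleteSpace E := hE.completeSpace_coe
    have hcl : IsClosed (Set.range π) := hπ.isClosedEmbedding.isClosed_range
    intro m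
    have hm : m.1 ∈ Set.range π := by
      refine closure_minimal ?_ hcl m.2
      intro m hm
      obtain ⟨p, rfl⟩ := adjoin_eq_lift hx hm
      have hpE : FreeNonUnitalNonAssocAlgebra.lift ℂ z p ∈ E := by
        let F : FreeNonUnitalNonAssocAlgebra ℂ X →ₙₐ[ℂ] E :=
          FreeNonUnitalNonAssocAlgebra.lift ℂ fun i => (⟨z i, hz i⟩ : E)
        have h2 := FreeNonUnitalNonAssocAlgebra.hom_ext (R := ℂ)
          (F₁ := ((NonUnitalStarSubalgebraClass.subtype E : E →⋆ₙₐ[ℂ] M × N) :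
            E →ₙₐ[ℂ] M × N).comp F)
          (F₂ := FreeNonUnitalNonAssocAlgebra.lift ℂ z) (by
            intro i
            simp [F]
            rfl)
        rw [← h2]
        exact (F p).2
      exact ⟨⟨_, hpE⟩, hfst p⟩
    obtain ⟨q, hq⟩ := hm
    exact ⟨q.1.2, by rw [← hq]; exact q.2⟩
  have huniq : ∀ m n n', (m, n) ∈ E → (m, n') ∈ E → n = n' := by
    intro m n n' h1 h2
    have := hnorm _ (sub_mem h1 h2)
    rw [← sub_eq_zero, ← norm_le_zero_iff]
    simpa using this
  refine ⟨{ toFun := fun m => (hex m).choose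
            map_smul' := fun c m => huniq _ _ _ (hex _).choose_spec
              (E.smul_mem c (hex m).choose_spec)
            map_zero' := huniq _ _ _ (hex _).choose_spec (zero_mem E)
            map_add' := fun m n => huniq _ _ _ (hex _).choose_spec
              (add_mem (hex m).choose_spec (hex n).choose_spec)
            map_mul' := fun m n => huniq _ _ _ (hex _).choose_spec
              (mul_mem (hex m).choose_spec (hex n).choose_spec)
            map_star' := fun m => huniq _ _ _ (hex _).choose_spec
              (star_mem (hex m).choose_spec) },
    fun i hi => huniq _ _ _ (hex ⟨x i, hi⟩).choose_spec (hz i)⟩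

end Graph

end Generalities

/-! ### Norm estimates and continuity in a crossed product. -/

section CrossedProductTools

variable {G : Type u} [Group G] [TopologicalSpace G] [IsTopologicalGroup G] [LocallyCompactSpace G]
  {A : Type v} [NonUnitalCStarAlgebra A] {α : G →* (A ≃⋆ₐ[ℂ] A)}

theorem integrable_haarMeasure {E : Type*} [NormedAddCommGroup E] {f : G → E} (hf : Continuous f)
    (hs : HasCompactSupport f) : MeasureTheory.Integrable f (haarMeasure G) := by
  let _ : MeasurableSpace G := borel G
  have _ : BorelSpace G := ⟨rfl⟩
  exact hf.integrable_of_hasCompactSupport (μ := MeasureTheory.Measure.haar) hs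

theorem CovariantRep.integratedForm_sub {H : Type w} [NormedAddCommGroup H] [InnerProductSpace ℂ H]
    [CompleteSpace H] (R : CovariantRep α H) (f f' : C_c(G, A)) :
    R.integratedForm (f - f') = R.integratedForm f - R.integratedForm f' := by
  ext ξ
  rw [sub_apply, integratedForm_apply, integratedForm_apply,
    integratedForm_apply, ← MeasureTheory.integral_sub (R.integrable_integrand f ξ)
      (R.integrable_integrand f' ξ)]
  simp

/-- The projection of the universal product onto one of its factors. -/
def UniversalProduct.compHom (j : RepIndex α) : UniversalProduct α →⋆ₙₐ[ℂ] RepOp α j where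
  toFun x := x.comp j
  map_smul' _ _ := rfl
  map_zero' := rfl
  map_add' _ _ := rfl
  map_mul' _ _ := rfl
  map_star' _ := rfl

theorem norm_universalForm_le (f : C_c(G, A)) :
    ‖(universalForm f : UniversalProduct α)‖ ≤ ∫ s, ‖f s‖ ∂(haarMeasure G) :=
  lp.norm_le_of_forall_le (MeasureTheory.integral_nonneg fun _ => norm_nonneg _)
    fun j => j.2.norm_integratedForm_le f

namespace CrossedProduct

variable (α) in
/-- The inclusion of the crossed product into the universal product. -/
def incl : CrossedProduct α →⋆ₙₐ[ℂ] UniversalProduct α where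
  toFun x := x.1
  map_smul' _ _ := rfl
  map_zero' := rfl
  map_add' _ _ := rfl
  map_mul' _ _ := rfl
  map_star' _ := rfl

theorem incl_injective : Function.Injective (incl α) := fun _ _ h => Subtype.ext h

theorem incl_of (f : C_c(G, A)) : incl α (of f) = universalForm f := rfl

theorem of_sub (f f' : C_c(G, A)) : (of (f - f') : CrossedProduct α) = of f - of f' :=
  incl_injective (UniversalProduct.ext fun j => j.2.integratedForm_sub f f')

theorem norm_of_le (f : C_c(G, A)) :
    ‖(of f : CrossedProduct α)‖ ≤ ∫ s, ‖f s‖ ∂(haarMeasure G) :=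
  norm_universalForm_le f

/-- Families of functions that are jointly continuous and locally supported in a common compact set
depend continuously on the parameter, as elements of the crossed product. -/
theorem continuous_of {X : Type*} [TopologicalSpace X] {Φ : X → C_c(G, A)}
    (hc : Continuous fun p : X × G => Φ p.1 p.2)
    (hs : ∀ x, ∃ t ∈ 𝓝 x, ∃ k : Set G, IsCompact k ∧ ∀ y ∈ t, ∀ g ∉ k, Φ y g = 0) :
    Continuous fun x => (of (Φ x) : CrossedProduct α) := by
  let _ : MeasurableSpace G := borel G
  have _ : BorelSpace G := ⟨rfl⟩
  refine continuous_iff_continuousAt.2 fun x => ?_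
  obtain ⟨t, ht, k, hk, htk⟩ := hs x
  have h : ContinuousOn (fun y => ∫ g, ‖Φ y g - Φ x g‖ ∂MeasureTheory.Measure.haar) t := by
    refine continuousOn_integral_of_compact_support hk (Continuous.continuousOn ?_) ?_
    · exact (hc.sub ((Φ x).continuous.comp continuous_snd)).norm
    · intro y g hy hg
      rw [htk y hy g hg, htk x (mem_of_mem_nhds ht) g hg, sub_zero, norm_zero]
  have h0 := (h.continuousAt ht).tendsto
  simp only [sub_self, norm_zero, MeasureTheory.integral_zero] at h0
  refine tendsto_iff_norm_sub_tendsto_zero.2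
    (squeeze_zero (fun _ => norm_nonneg _) (fun y => ?_) h0)
  rw [← of_sub]
  exact norm_of_le _

end CrossedProduct

end CrossedProductTools

/-! ### The crossed product by a trivial action and its canonical multipliers. -/

section Representations

variable {K : Type u} [CommGroup K] [TopologicalSpace K] [IsTopologicalGroup K]
  [LocallyCompactSpace K] {A : Type v} [NonUnitalCStarAlgebra A]

/-- The involution `f*(k) = f(k⁻¹)*`. -/
def starFun (f : C_c(K, A)) : C_c(K, A) where
  toFun k := star (f k⁻¹)
  continuous_toFun := (f.continuous.comp continuous_inv).star
  hasCompactSupport' := (f.hasCompactSupport.comp_homeomorph (Homeomorph.inv K)).comp_left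
    (g := star) (star_zero A)

/-- Substitute $k\mapsto k^{-1}$ under the integral of matrix coefficients. Haar measure of an
abelian group is inversion invariant, and $U(k)$ commutes with $\pi(a)$ because the action is
trivial. -/
theorem CovariantRep.integratedForm_starFun {H : Type w} [NormedAddCommGroup H]
    [InnerProductSpace ℂ H] [CompleteSpace H] (R : CovariantRep (trivialAction K A) H)
    (f : C_c(K, A)) : R.integratedForm (starFun f) = star (R.integratedForm f) := by
  let _ : MeasurableSpace K := borel K
  have _ : BorelSpace K := ⟨rfl⟩
  ext ξ
  refine ext_inner_left ℂ fun η => ?_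
  rw [ContinuousLinearMap.star_eq_adjoint, ContinuousLinearMap.adjoint_inner_right,
    integratedForm_apply, integratedForm_apply, ← integral_inner (R.integrable_integrand _ ξ),
    ← inner_conj_symm, ← integral_inner (R.integrable_integrand _ η), ← integral_conj]
  refine (MeasureTheory.integral_inv_eq_self (μ := MeasureTheory.Measure.haar)
    (fun k => inner ℂ η (R.π (starFun f k) ((R.U k : H →L[ℂ] H) ξ)))).symm.trans ?_
  refine MeasureTheory.integral_congr_ae (Filter.Eventually.of_forall fun k => ?_)
  beta_reduce
  have h1 : R.π (starFun f k⁻¹) = star (R.π (f k)) := by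
    change R.π (star (f k⁻¹⁻¹)) = _
    rw [inv_inv, map_star]
  have h2 : (R.U k⁻¹ : H →L[ℂ] H) = star (R.U k : H →L[ℂ] H) := by rw [map_inv]; rfl
  have h3 := congrArg (fun T : H →L[ℂ] H => T η) (R.U_mul_π k (f k))
  simp only [mul_apply_eq_comp] at h3
  rw [inner_conj_symm, h1, h2, ContinuousLinearMap.star_eq_adjoint,
    ContinuousLinearMap.star_eq_adjoint, ContinuousLinearMap.adjoint_inner_right,
    ContinuousLinearMap.adjoint_inner_right, h3]

theorem CrossedProduct.star_of (f : C_c(K, A)) :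
    star (of f : CrossedProduct (trivialAction K A)) = of (starFun f) :=
  incl_injective (UniversalProduct.ext fun j => (j.2.integratedForm_starFun f).symm)

/-- There is no case for adjoints: the image of $C_c(K,A)$ is already closed under the involution by
`CrossedProduct.star_of`. -/
theorem CrossedProduct.induction {P : CrossedProduct (trivialAction K A) → Prop}
    (closed : IsClosed {x | P x}) (of : ∀ f, P (of f)) (zero : P 0)
    (add : ∀ x y, P x → P y → P (x + y)) (smul : ∀ (c : ℂ) x, P x → P (c • x))
    (mul : ∀ x y, P x → P y → P (x * y)) (x : CrossedProduct (trivialAction K A)) : P x := by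
  have hcl : IsClosed (incl (trivialAction K A) '' {x | P x}) :=
    (NonUnitalStarAlgHom.isometry _ incl_injective).isClosedEmbedding.isClosedMap _ closed
  have h : incl (trivialAction K A) x ∈ incl (trivialAction K A) '' {x | P x} := by
    refine closure_minimal ?_ hcl x.2
    intro y hy
    have hy' : y ∈ NonUnitalAlgebra.adjoin ℂ (Set.range (universalForm : C_c(K, A) →
      UniversalProduct (trivialAction K A)) ∪ star (Set.range universalForm)) := hy
    clear hy
    induction hy' using NonUnitalAlgebra.adjoin_induction with
    | mem y hy =>
      rcases hy with ⟨f, rfl⟩ | ⟨f, hf⟩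
      · exact ⟨_, of f, rfl⟩
      · refine ⟨_, of (starFun f), ?_⟩
        rw [← star_star y, ← hf, ← incl_of, ← map_star, star_of]
    | add y z _ _ ihy ihz =>
      obtain ⟨y, hy, rfl⟩ := ihy
      obtain ⟨z, hz, rfl⟩ := ihz
      exact ⟨_, add y z hy hz, map_add _ _ _⟩
    | zero => exact ⟨0, zero, map_zero _⟩
    | mul y z _ _ ihy ihz =>
      obtain ⟨y, hy, rfl⟩ := ihy
      obtain ⟨z, hz, rfl⟩ := ihz
      exact ⟨_, mul y z hy hz, map_mul _ _ _⟩
    | smul c y _ ihy =>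
      obtain ⟨y, hy, rfl⟩ := ihy
      exact ⟨_, smul c y hy, map_smul _ _ _⟩
  obtain ⟨y, hy, hxy⟩ := h
  exact incl_injective hxy ▸ hy

/-! ### The canonical multipliers -/

variable (K A) in
/-- The family of all `π(a)`, for the members `(π, U)` of the universal family. -/
def coeffHom : A →⋆ₙₐ[ℂ] UniversalProduct (trivialAction K A) where
  toFun a := UniversalProduct.mk (fun j => j.2.π a) ‖a‖
    fun j => NonUnitalStarAlgHom.norm_apply_le j.2.π a
  map_smul' c a := UniversalProduct.ext fun j => map_smul j.2.π c a
  map_zero' := UniversalProduct.ext fun j => map_zero j.2.π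
  map_add' a b := UniversalProduct.ext fun j => map_add j.2.π a b
  map_mul' a b := UniversalProduct.ext fun j => map_mul j.2.π a b
  map_star' a := UniversalProduct.ext fun j => map_star j.2.π a

/-- The function `k ↦ a f(k)`. -/
def coeffMulFun (a : A) (f : C_c(K, A)) : C_c(K, A) where
  toFun k := a * f k
  continuous_toFun := continuous_const.mul f.continuous
  hasCompactSupport' := f.hasCompactSupport.comp_left (g := (a * ·)) (mul_zero a)

theorem coeffHom_mul_of (a : A) (f : C_c(K, A)) :
    coeffHom K A a * universalForm f = universalForm (coeffMulFun a f) := by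
  refine UniversalProduct.ext fun j => ContinuousLinearMap.ext fun ξ => ?_
  let _ : MeasurableSpace K := borel K
  refine ((j.2.π a).integral_comp_comm (j.2.integrable_integrand f ξ)).symm.trans ?_
  refine MeasureTheory.integral_congr_ae (Filter.Eventually.of_forall fun k => ?_)
  exact congrArg (fun T : RepOp _ j => T _) (map_mul j.2.π a (f k)).symm

theorem coeffHom_mul_mem (a : A) (x : CrossedProduct (trivialAction K A)) :
    ∃ y, CrossedProduct.incl _ y = coeffHom K A a * CrossedProduct.incl _ x := by
  induction x using CrossedProduct.induction with
  | closed =>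
    have hcl : IsClosed (Set.range (CrossedProduct.incl (trivialAction K A))) :=
      (NonUnitalStarAlgHom.isometry _
        CrossedProduct.incl_injective).isClosedEmbedding.isClosed_range
    exact hcl.preimage (continuous_const.mul (continuous_starHom _))
  | of f => exact ⟨CrossedProduct.of (coeffMulFun a f), (coeffHom_mul_of a f).symm⟩
  | zero => exact ⟨0, by rw [map_zero, mul_zero]⟩
  | add x y hx hy =>
    obtain ⟨x', hx⟩ := hx
    obtain ⟨y', hy⟩ := hy
    exact ⟨x' + y', by rw [map_add, map_add, hx, hy, mul_add]⟩
  | smul c x hx =>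
    obtain ⟨x', hx⟩ := hx
    exact ⟨c • x', by rw [map_smul, map_smul, hx, mul_smul_comm]⟩
  | mul x y hx hy =>
    obtain ⟨x', hx⟩ := hx
    exact ⟨x' * y, by rw [map_mul, map_mul, hx, mul_assoc]⟩

variable (K A) in
/-- The canonical homomorphism of `A` into the multipliers of `A ⋊ K` (trivial action): on
`C_c(K, A)` it is `(a f)(k) = a f(k)`. -/
def coeffMultiplier : A →⋆ₙₐ[ℂ] 𝓜(ℂ, CrossedProduct (trivialAction K A)) :=
  multiplierHom (CrossedProduct.incl _) CrossedProduct.incl_injective (coeffHom K A)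
    coeffHom_mul_mem

theorem coeffMultiplier_fst (a : A) (x : CrossedProduct (trivialAction K A)) :
    CrossedProduct.incl _ ((coeffMultiplier K A a).fst x) =
      coeffHom K A a * CrossedProduct.incl _ x :=
  multiplierHom_fst _ CrossedProduct.incl_injective _ coeffHom_mul_mem a x

/-- For contractions, closeness of vectors gives uniform closeness of orbits, and uniform limits of
continuous functions are continuous. -/
theorem isClosed_setOf_continuous_apply {X E : Type*} [TopologicalSpace X] [NormedAddCommGroup E]
    [NormedSpace ℂ E] (V : X → E →L[ℂ] E) (hV : ∀ k x, ‖V k x‖ ≤ ‖x‖) :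
    IsClosed {x | Continuous fun k => V k x} := by
  refine isClosed_of_closure_subset fun x hx => ?_
  refine continuous_of_uniform_approx_of_continuous fun t ht => ?_
  obtain ⟨ε, hε, ht⟩ := Metric.mem_uniformity_dist.1 ht
  obtain ⟨y, hy, hxy⟩ := Metric.mem_closure_iff.1 hx ε hε
  refine ⟨fun k => V k y, hy, fun k => ht ?_⟩
  rw [dist_eq_norm, ← map_sub]
  exact (hV k _).trans_lt (dist_eq_norm x y ▸ hxy)

theorem norm_translationMultiplier_fst_le (s : K) (x : CrossedProduct (trivialAction K A)) :
    ‖(translationMultiplier s).fst x‖ ≤ ‖x‖ := by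
  refine ((translationMultiplier s).fst.le_opNorm x).trans
    (mul_le_of_le_one_left (norm_nonneg _) ?_)
  rw [DoubleCentralizer.norm_fst]
  -- Unitaries have norm one only in a nonzero algebra, so the zero algebra is treated apart.
  cases subsingleton_or_nontrivial 𝓜(ℂ, CrossedProduct (trivialAction K A))
  · rw [Subsingleton.elim (translationMultiplier s) 0, norm_zero]
    exact zero_le_one
  · exact (CStarRing.norm_of_mem_unitary (canonicalUnitary K A s).2).le

theorem translationMultiplier_of (s : K) (f : C_c(K, A)) :
    (translationMultiplier s).fst (CrossedProduct.of f : CrossedProduct (trivialAction K A)) =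
      CrossedProduct.of (translate s f) :=
  CrossedProduct.incl_injective (UniversalProduct.ext fun j => j.2.U_mul_integratedForm s f)

theorem continuous_translationMultiplier_fst (x : CrossedProduct (trivialAction K A)) :
    Continuous fun s => (translationMultiplier s).fst x := by
  induction x using CrossedProduct.induction with
  | closed =>
    exact isClosed_setOf_continuous_apply (fun s => (translationMultiplier s).fst)
      norm_translationMultiplier_fst_le
  | of f =>
    simp only [translationMultiplier_of]
    refine CrossedProduct.continuous_of (f.continuous.comp (by fun_prop)) fun s => ?_
    -- For $y$ in a compact neighbourhood $t$ of $s$, all translates by $y$ are supported in the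
    -- compact set $t\cdot\operatorname{supp}f$.
    obtain ⟨t, ht, hts⟩ := exists_compact_mem_nhds s
    refine ⟨t, hts, (fun p : K × K => p.1 * p.2) '' (t ×ˢ tsupport f),
      (ht.prod f.hasCompactSupport).image continuous_mul,  fun y hy k hk => ?_⟩
    rw [translate_apply]
    refine image_eq_zero_of_notMem_tsupport fun h => hk ?_
    exact ⟨(y, y⁻¹ * k), ⟨hy, h⟩, mul_inv_cancel_left y k⟩
  | zero => simpa only [map_zero] using continuous_const
  | add x y hx hy =>
    simp only [map_add]
    exact Continuous.add hx hy
  | smul c x hx =>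
    simp only [map_smul]
    exact Continuous.const_smul hx c
  | mul x y hx _ =>
    simp only [multiplier_fst_mul]
    exact Continuous.mul hx continuous_const

/-- Evaluation of a representation at a vector. -/
def evalRep {D : Type*} [NonUnitalCStarAlgebra D] {H : Type*} [NormedAddCommGroup H]
    [InnerProductSpace ℂ H] [CompleteSpace H] (ρ : D →⋆ₙₐ[ℂ] (H →L[ℂ] H)) (ξ : H) : D →L[ℂ] H :=
  (ContinuousLinearMap.apply ℂ H ξ).comp (σ₁₂ := RingHom.id ℂ)
    ⟨{ toFun := ρ, map_add' := map_add ρ, map_smul' := fun c d => map_smul ρ c d },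
      continuous_starHom ρ⟩

theorem continuous_coeff_translation (f : C_c(K, A)) (x : CrossedProduct (trivialAction K A)) :
    Continuous fun k => (coeffMultiplier K A (f k)).fst ((translationMultiplier k).fst x) := by
  exact (continuous_multiplier_fst.comp ((continuous_starHom _).comp f.continuous)).clm_apply
    (continuous_translationMultiplier_fst x)

theorem integrable_coeff_translation (f : C_c(K, A)) (x : CrossedProduct (trivialAction K A)) :
    MeasureTheory.Integrable
      (fun k => (coeffMultiplier K A (f k)).fst ((translationMultiplier k).fst x))
      (haarMeasure K) := by
  refine integrable_haarMeasure (continuous_coeff_translation f x)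
    (f.hasCompactSupport.mono fun k hk hf => hk ?_)
  simp [hf]

/-- Left multiplication by `f ∈ C_c(K, A)` in `A ⋊ K` is the integral `∫ f(k) u(k) dk` of
multipliers, in the strict topology. -/
theorem CrossedProduct.of_mul (f : C_c(K, A)) (x : CrossedProduct (trivialAction K A)) :
    of f * x = ∫ k, (coeffMultiplier K A (f k)).fst ((translationMultiplier k).fst x)
      ∂(haarMeasure K) := by
  refine incl_injective (UniversalProduct.ext fun j => ContinuousLinearMap.ext fun ξ => ?_)
  let _ : MeasurableSpace K := borel K
  have h := ContinuousLinearMap.integral_comp_comm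
    (evalRep ((UniversalProduct.compHom j).comp (incl (trivialAction K A))) ξ)
    (integrable_coeff_translation f x)
  refine Eq.trans ?_ h
  change j.2.integratedForm f ((x.1.comp j) ξ) = _
  rw [CovariantRep.integratedForm_apply]
  refine MeasureTheory.integral_congr_ae (Filter.Eventually.of_forall fun k => ?_)
  change _ = (incl _ ((coeffMultiplier K A (f k)).fst ((translationMultiplier k).fst x))).comp j ξ
  rw [coeffMultiplier_fst]
  rfl

end Representations

/-! ### Disintegration of non-degenerate representations of $A\rtimes K$ for a trivial action. -/

section Disintegration

theorem isNondegenerateRep_of_orthogonal {A : Type*} [NonUnitalCStarAlgebra A] {H : Type*}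
    [NormedAddCommGroup H] [InnerProductSpace ℂ H] [CompleteSpace H] {π : A →⋆ₙₐ[ℂ] (H →L[ℂ] H)}
    (h : ∀ ζ : H, (∀ a ξ, inner ℂ ζ (π a ξ) = 0) → ζ = 0) : IsNondegenerateRep π := by
  rw [IsNondegenerateRep, Submodule.dense_iff_topologicalClosure_eq_top,
    Submodule.topologicalClosure_eq_top_iff, Submodule.eq_bot_iff]
  intro ζ hζ
  refine h ζ fun a ξ => ?_
  exact (Submodule.mem_orthogonal' _ _).1 hζ _ (Submodule.subset_span ⟨a, ξ, rfl⟩)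

theorem IsNondegenerateRep.eq_zero_of_orthogonal {A : Type*} [NonUnitalCStarAlgebra A] {H : Type*}
    [NormedAddCommGroup H] [InnerProductSpace ℂ H] [CompleteSpace H] {π : A →⋆ₙₐ[ℂ] (H →L[ℂ] H)}
    (hπ : IsNondegenerateRep π) {ζ : H} (h : ∀ a ξ, inner ℂ ζ (π a ξ) = 0) : ζ = 0 := by
  have h2 : innerSL ℂ ζ = 0 := hπ.ext fun a ξ => by simpa using h a ξ
  have h3 := congrArg (fun t : H →L[ℂ] ℂ => t ζ) h2
  simpa using h3

variable {K : Type u} [CommGroup K] [TopologicalSpace K] [IsTopologicalGroup K]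
  [LocallyCompactSpace K] {A : Type v} [NonUnitalCStarAlgebra A]

theorem translationMultiplier_mul_coeffMultiplier (s : K) (a : A) :
    translationMultiplier s * coeffMultiplier K A a =
      coeffMultiplier K A a * translationMultiplier s := by
  refine multiplier_ext_fst fun x => CrossedProduct.incl_injective ?_
  refine Eq.trans ?_ (coeffMultiplier_fst a ((translationMultiplier s).fst x)).symm
  refine (congrArg (universalUnitary A s * ·) (coeffMultiplier_fst a x)).trans ?_
  refine UniversalProduct.ext fun j => ?_
  change (j.2.U s : RepOp _ j) * (j.2.π a * x.1.comp j) =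
    j.2.π a * ((j.2.U s : RepOp _ j) * x.1.comp j)
  rw [← mul_assoc, j.2.U_mul_π, mul_assoc]

variable {H : Type w} [NormedAddCommGroup H] [InnerProductSpace ℂ H] [CompleteSpace H]
  {ρ : CrossedProduct (trivialAction K A) →⋆ₙₐ[ℂ] (H →L[ℂ] H)}

theorem integrable_rep_coeff_translation
    (ρ : CrossedProduct (trivialAction K A) →⋆ₙₐ[ℂ] (H →L[ℂ] H)) (f : C_c(K, A))
    (x : CrossedProduct (trivialAction K A)) (ξ : H) : MeasureTheory.Integrable
      (fun k => ρ ((coeffMultiplier K A (f k)).fst ((translationMultiplier k).fst x)) ξ)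
      (haarMeasure K) :=
  (evalRep ρ ξ).integrable_comp (integrable_coeff_translation f x)

theorem rep_of_mul_apply (ρ : CrossedProduct (trivialAction K A) →⋆ₙₐ[ℂ] (H →L[ℂ] H))
    (f : C_c(K, A)) (x : CrossedProduct (trivialAction K A)) (ξ : H) :
    ρ (CrossedProduct.of f * x) ξ =
      ∫ k, ρ ((coeffMultiplier K A (f k)).fst ((translationMultiplier k).fst x)) ξ
        ∂(haarMeasure K) := by
  let _ : MeasurableSpace K := borel K
  rw [CrossedProduct.of_mul]
  exact ((evalRep ρ ξ).integral_comp_comm (integrable_coeff_translation f x)).symm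

/-- The representation of `A` defined by a non-degenerate representation of `A ⋊ K` (trivial
action). -/
def coeffRep (hρ : IsNondegenerateRep ρ) : A →⋆ₙₐ[ℂ] (H →L[ℂ] H) :=
  (hρ.extension : _ →⋆ₙₐ[ℂ] (H →L[ℂ] H)).comp (coeffMultiplier K A)

/-- A vector $\zeta$ orthogonal to the range of the representation of $A$ is orthogonal to every
$\rho(fx)\xi$ with $f\in C_c(K,A)$, since inner products pass under the integral formula
`rep_of_mul_apply`. By density $\zeta\perp\rho(yx)\xi$ for all $y$, hence $\zeta=0$. -/
theorem nondegenerate_coeff (hρ : IsNondegenerateRep ρ) :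
    IsNondegenerateRep (coeffRep hρ) := by
  refine isNondegenerateRep_of_orthogonal fun ζ hζ => ?_
  have h : ∀ y x : CrossedProduct (trivialAction K A), ∀ ξ, inner ℂ ζ (ρ (y * x) ξ) = 0 := by
    intro y
    induction y using CrossedProduct.induction with
    | closed =>
      simp only [Set.ofPred_forall]
      refine isClosed_iInter fun x => isClosed_iInter fun ξ => isClosed_eq ?_ continuous_const
      exact (continuous_const (y := ζ)).inner
        ((evalRep ρ ξ).continuous.comp (continuous_id.mul (continuous_const (y := x))))
    | of f =>
      intro x ξ
      rw [rep_of_mul_apply, ← integral_inner (integrable_rep_coeff_translation ρ f x ξ),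
        ← MeasureTheory.integral_zero K ℂ (μ := haarMeasure K)]
      congr 1
      ext k
      rw [← hρ.extension_apply]
      exact hζ (f k) _
    | zero => simp
    | add x y hx hy =>
      intro z ξ
      rw [add_mul, map_add, add_apply, inner_add_right, hx, hy, add_zero]
    | smul c x hx =>
      intro z ξ
      rw [smul_mul_assoc, map_smul, smul_apply, inner_smul_right, hx, mul_zero]
    | mul x y hx hy => intro z ξ; rw [mul_assoc, hx]
  refine hρ.eq_zero_of_orthogonal fun x ξ => ?_
  -- Orthogonality is known only on products $yx$; an approximate unit removes the left factor.
  obtain ⟨l, hl, -⟩ := exists_approximateUnit (CrossedProduct (trivialAction K A))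
  have := hl.neBot
  have h1 : Tendsto (fun e => inner ℂ ζ (ρ (e * x) ξ)) l (𝓝 (inner ℂ ζ (ρ x ξ))) :=
    tendsto_const_nhds.inner
      ((evalRep ρ ξ).continuous.continuousAt.tendsto.comp (hl.tendsto_mul_right x))
  simp only [h] at h1
  exact (tendsto_nhds_unique h1 tendsto_const_nhds)

/-- The unitaries of a non-degenerate representation of `A ⋊ K` (trivial action). -/
def translationUnitary (hρ : IsNondegenerateRep ρ) : K →* unitary (H →L[ℂ] H) where
  toFun k := ⟨hρ.extension (translationMultiplier k),
    Unitary.map_mem hρ.extension (canonicalUnitary K A k).2⟩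
  map_one' := Subtype.ext (by
    change hρ.extension (translationMultiplier 1) = 1
    rw [translationMultiplier_one, map_one])
  map_mul' k l := Subtype.ext (by
    change hρ.extension (translationMultiplier (k * l)) =
      hρ.extension (translationMultiplier k) * hρ.extension (translationMultiplier l)
    rw [translationMultiplier_mul, map_mul])

/-- Vectors with continuous orbits form a closed subspace. It contains every $\rho(x)\eta$, because
translation is norm continuous on the crossed product, and non-degeneracy makes it everything. -/
theorem continuous_extension_translation (hρ : IsNondegenerateRep ρ) (ξ : H) :
    Continuous fun s => (translationUnitary hρ s : H →L[ℂ] H) ξ := by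
  let V : K → H →L[ℂ] H := fun s => hρ.extension (translationMultiplier s)
  have hV : ∀ s ξ, ‖V s ξ‖ ≤ ‖ξ‖ := fun s ξ =>
    (Unitary.norm_map (translationUnitary hρ s) ξ).le
  let S : Submodule ℂ H :=
    { carrier := {ξ | Continuous fun s => V s ξ}
      add_mem' := fun {ξ η} hξ hη => by
        change Continuous fun s => V s (ξ + η)
        simp only [map_add]
        exact Continuous.add hξ hη
      zero_mem' := by
        change Continuous fun s => V s 0
        simp only [map_zero]
        exact continuous_const
      smul_mem' := fun c ξ hξ => by
        change Continuous fun s => V s (c • ξ)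
        simp only [map_smul]
        exact Continuous.const_smul hξ c }
  have hS : IsClosed (S : Set H) := isClosed_setOf_continuous_apply V hV
  have hle : Submodule.span ℂ {x : H | ∃ a η, ρ a η = x} ≤ S := by
    refine Submodule.span_le.2 ?_
    rintro _ ⟨x, η, rfl⟩
    change Continuous fun s => V s (ρ x η)
    simp only [V, hρ.extension_apply]
    exact (evalRep ρ η).continuous.comp (continuous_translationMultiplier_fst x)
  exact closure_minimal hle hS (hρ ξ)

theorem translationUnitary_coeffRep (hρ : IsNondegenerateRep ρ) (k : K) (a : A) :
    (translationUnitary hρ k : H →L[ℂ] H) * coeffRep hρ a *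
      star (translationUnitary hρ k : H →L[ℂ] H) = coeffRep hρ a := by
  have h1 : (translationUnitary hρ k : H →L[ℂ] H) * coeffRep hρ a =
      coeffRep hρ a * (translationUnitary hρ k : H →L[ℂ] H) := by
    have h2 := congrArg hρ.extension (translationMultiplier_mul_coeffMultiplier k a)
    rw [map_mul, map_mul] at h2
    exact h2
  rw [h1, mul_assoc, Unitary.mul_star_self_of_mem (translationUnitary hρ k).2, mul_one]

/-- The covariant representation of which a given non-degenerate representation of `A ⋊ K` (trivial
action) is the integrated form. -/
def IsNondegenerateRep.covariantRep (hρ : IsNondegenerateRep ρ) :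
    CovariantRep (trivialAction K A) H where
  π := coeffRep hρ
  U := translationUnitary hρ
  nondegenerate := nondegenerate_coeff hρ
  continuous_U := continuous_extension_translation hρ
  covariant := translationUnitary_coeffRep hρ

theorem IsNondegenerateRep.covariantRep_π (hρ : IsNondegenerateRep ρ) (a : A) :
    hρ.covariantRep.π a = hρ.extension (coeffMultiplier K A a) := rfl

theorem IsNondegenerateRep.covariantRep_U (hρ : IsNondegenerateRep ρ) (k : K) :
    (hρ.covariantRep.U k : H →L[ℂ] H) = hρ.extension (translationMultiplier k) := rfl

/-- On vectors $\rho(x)\xi$ the extended multipliers act through $x$, and the identity becomes the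
strict integral formula for $f\cdot x$. -/
theorem IsNondegenerateRep.integratedForm_covariantRep (hρ : IsNondegenerateRep ρ)
    (f : C_c(K, A)) : hρ.covariantRep.integratedForm f = ρ (CrossedProduct.of f) := by
  refine hρ.ext fun x ξ => ?_
  rw [← mul_apply_eq_comp (ρ _) (ρ x) ξ, ← map_mul, rep_of_mul_apply,
    CovariantRep.integratedForm_apply]
  congr 1
  ext k
  rw [covariantRep_π, covariantRep_U, hρ.extension_apply, hρ.extension_apply]

/-- A non-degenerate representation of `ℂ` is scalar multiplication. -/
theorem IsNondegenerateRep.apply_complex {π : ℂ →⋆ₙₐ[ℂ] (H →L[ℂ] H)} (hπ : IsNondegenerateRep π)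
    (z : ℂ) : π z = z • 1 := by
  have h1 : π 1 = 1 := hπ.ext_mul fun z => by rw [← map_mul, one_mul, one_mul]
  rw [← h1, ← map_smul, smul_eq_mul, mul_one]

/-- If `T` is the representation of `C*(K)` that corresponds to the unitary representation `V`, then
`T(f) = ∫ f(k) V(k) dk` for `f ∈ C_c(K)`. -/
theorem groupRep_of_apply {T : GroupCStarAlgebra K →⋆ₙₐ[ℂ] (H →L[ℂ] H)}
    (hT : IsNondegenerateRep T) {V : K → H →L[ℂ] H}
    (hV : ∀ k, IsExtensionValue T (groupUnitary K k : 𝓜(ℂ, GroupCStarAlgebra K)) (V k))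
    (f : C_c(K, ℂ)) (ξ : H) : MeasureTheory.Integrable (fun k => f k • V k ξ) (haarMeasure K) ∧
      T (CrossedProduct.of f) ξ = ∫ k, f k • V k ξ ∂(haarMeasure K) := by
  have h : ∀ k, hT.covariantRep.π (f k) ((hT.covariantRep.U k : H →L[ℂ] H) ξ) = f k • V k ξ := by
    intro k
    -- Non-degeneracy makes the extension value at $\eta(k)$ unique, so `V` is the unitary part of
    -- the disintegration of `T`.
    have h1 : (hT.covariantRep.U k : H →L[ℂ] H) = V k := hT.ext_mul fun d => by
      rw [hV k d, hT.covariantRep_U, hT.extension_mul]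
      rfl
    rw [hT.covariantRep.nondegenerate.apply_complex, h1]
    rfl
  simp only [← h]
  refine ⟨hT.covariantRep.integrable_integrand f ξ, ?_⟩
  rw [← hT.integratedForm_covariantRep]
  rfl

end Disintegration

/-! ### A universal candidate for the host, and a criterion for it to be one. -/

section ExistenceCriterion

/-- An $\varepsilon/3$ argument for eventually contractive operators. It allows strong convergence
to the identity to be checked on dense sets only. -/
theorem isClosed_setOf_tendsto_apply {X E : Type*} [NormedAddCommGroup E] [NormedSpace ℂ E]
    {F : Filter X} (V : X → E →L[ℂ] E) (hV : ∀ᶠ e in F, ∀ x, ‖V e x‖ ≤ ‖x‖) :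
    IsClosed {x | Tendsto (fun e => V e x) F (𝓝 x)} := by
  refine isClosed_of_closure_subset fun x hx => ?_
  refine Metric.tendsto_nhds.2 fun ε hε => ?_
  obtain ⟨y, hy, hxy⟩ := Metric.mem_closure_iff.1 hx (ε / 3) (by positivity)
  filter_upwards [hV, Metric.tendsto_nhds.1 hy (ε / 3) (by positivity)] with e he hey
  have h1 : dist (V e x) (V e y) ≤ dist x y := by
    rw [dist_eq_norm, dist_eq_norm, ← map_sub]
    exact he _
  linarith [dist_triangle4 (V e x) (V e y) y x, dist_comm x y]

variable {G : Type*} [Group G] [TopologicalSpace G] {A : Type u} [NonUnitalCStarAlgebra A]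
  {L : Type v} [NonUnitalCStarAlgebra L]

/-- A covariant representation `(π, U)` of `(A, G, α)` together with the representation `T` of the
host algebra `(L, η)` that corresponds to `U`. -/
structure HostCovariantRep (α : G →* (A ≃⋆ₐ[ℂ] A)) (η : G →* unitary 𝓜(ℂ, L)) (H : Type*)
    [NormedAddCommGroup H] [InnerProductSpace ℂ H] [CompleteSpace H] extends
    CovariantRep α H where
  T : L →⋆ₙₐ[ℂ] (H →L[ℂ] H)
  nondegenerate_T : IsNondegenerateRep T
  isExtensionValue_U : ∀ g : G, IsExtensionValue T (η g : 𝓜(ℂ, L)) (U g : H →L[ℂ] H)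

variable {α : G →* (A ≃⋆ₐ[ℂ] A)} {η : G →* unitary 𝓜(ℂ, L)}

/-- The joint family of all `π(a)` and `T(l)`. -/
def HostCovariantRep.family {H : Type*} [NormedAddCommGroup H] [InnerProductSpace ℂ H]
    [CompleteSpace H] (R : HostCovariantRep α η H) : A ⊕ L → (H →L[ℂ] H) :=
  Sum.elim R.π R.T

variable (α η)

/-- The norm functions on noncommutative polynomials in `A ⊕ L` of the covariant representations of
`(A, G, α)`. -/
def hostNorms : Set (FreeNonUnitalNonAssocAlgebra ℂ (A ⊕ L) → ℝ) :=
  {n | ∃ (H : HilbertSpace.{w}) (R : HostCovariantRep α η H.carrier),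
    n = fun p => ‖FreeNonUnitalNonAssocAlgebra.lift ℂ R.family p‖}

/-- A Hilbert space carrying a covariant representation with a given norm function. -/
def hostSpace (n : hostNorms.{u, v, w} α η) : HilbertSpace.{w} := n.2.choose

/-- A covariant representation with a given norm function. -/
def hostRep (n : hostNorms.{u, v, w} α η) : HostCovariantRep α η (hostSpace α η n).carrier :=
  n.2.choose_spec.choose

/-- The operators on the Hilbert space of a member of the family. -/
abbrev HostOp (n : hostNorms.{u, v, w} α η) : Type w :=
  (hostSpace α η n).carrier →L[ℂ] (hostSpace α η n).carrier

/-- The `ℓ^∞`-product of the operator algebras of a small family of covariant representations in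
which every covariant representation is weakly contained. -/
def HostProduct : Type (max u v w) := lp (HostOp.{u, v, w} α η) ∞

instance : NonUnitalCStarAlgebra (HostProduct.{u, v, w} α η) :=
  inferInstanceAs (NonUnitalCStarAlgebra (lp (HostOp.{u, v, w} α η) ∞))

namespace HostProduct

variable {α η}

/-- The projection onto one of the factors. -/
def compHom (n : hostNorms.{u, v, w} α η) : HostProduct.{u, v, w} α η →⋆ₙₐ[ℂ] HostOp α η n where
  toFun x := x.1 n
  map_smul' _ _ := rfl
  map_zero' := rfl
  map_add' _ _ := rfl
  map_mul' _ _ := rfl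
  map_star' _ := rfl

theorem ext {x y : HostProduct.{u, v, w} α η} (h : ∀ n, compHom n x = compHom n y) : x = y :=
  Subtype.ext (funext h)

/-- A bounded family of operators as an element of the product. -/
def mk (x : ∀ n, HostOp.{u, v, w} α η n) (C : ℝ) (hx : ∀ n, ‖x n‖ ≤ C) :
    HostProduct.{u, v, w} α η :=
  ⟨x, memℓp_infty ⟨C, by rintro _ ⟨n, rfl⟩; exact hx n⟩⟩

theorem norm_le_of_forall {x : HostProduct.{u, v, w} α η} {C : ℝ} (hC : 0 ≤ C)
    (h : ∀ n, ‖compHom n x‖ ≤ C) : ‖x‖ ≤ C :=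
  lp.norm_le_of_forall_le hC h

/-- A family of representations as a homomorphism into the product. -/
def lift {D : Type*} [NonUnitalCStarAlgebra D]
    (φ : ∀ n : hostNorms.{u, v, w} α η, D →⋆ₙₐ[ℂ] HostOp α η n) :
    D →⋆ₙₐ[ℂ] HostProduct.{u, v, w} α η where
  toFun d := mk (fun n => φ n d) ‖d‖ fun n => NonUnitalStarAlgHom.norm_apply_le (φ n) d
  map_smul' c d := ext fun n => map_smul (φ n) c d
  map_zero' := ext fun n => map_zero (φ n)
  map_add' c d := ext fun n => map_add (φ n) c d
  map_mul' c d := ext fun n => map_mul (φ n) c d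
  map_star' d := ext fun n => map_star (φ n) d

variable (α η)

/-- The universal representation of `A`. -/
def π : A →⋆ₙₐ[ℂ] HostProduct.{u, v, w} α η := lift fun n => (hostRep α η n).π

/-- The universal representation of `L`. -/
def T : L →⋆ₙₐ[ℂ] HostProduct.{u, v, w} α η := lift fun n => (hostRep α η n).T

/-- The universal representation of `G`. -/
def U (g : G) : HostProduct.{u, v, w} α η :=
  mk (fun n => ((hostRep α η n).U g : HostOp α η n)) 1 fun n => by
    refine ContinuousLinearMap.opNorm_le_bound _ zero_le_one fun ξ => ?_
    rw [Unitary.norm_map, one_mul]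

theorem star_U (g : G) : star (U.{u, v, w} α η g) = U α η g⁻¹ := by
  refine ext fun n => ?_
  change star ((hostRep α η n).U g : HostOp α η n) = (hostRep α η n).U g⁻¹
  rw [map_inv]; rfl

theorem U_mul_T (g : G) (l : L) :
    U.{u, v, w} α η g * T α η l = T α η ((η g : 𝓜(ℂ, L)).fst l) :=
  ext fun n => (hostRep α η n).isExtensionValue_U g l

theorem U_mul_U_inv (g : G) (x : HostProduct.{u, v, w} α η) : U α η g * (U α η g⁻¹ * x) = x := by
  refine ext fun n => ?_
  change ((hostRep α η n).U g : HostOp α η n) * (((hostRep α η n).U g⁻¹ : HostOp α η n) *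
    compHom n x) = compHom n x
  rw [← mul_assoc, map_inv]
  exact (congrArg (· * compHom n x) (Unitary.mul_star_self_of_mem ((hostRep α η n).U g).2)).trans
    (one_mul _)

theorem U_mul_π (g : G) (a : A) :
    U.{u, v, w} α η g * π α η a = π α η (α g a) * U α η g := by
  refine ext fun n => ?_
  have h := (hostRep α η n).covariant g a
  change ((hostRep α η n).U g : HostOp α η n) * (hostRep α η n).π a =
    (hostRep α η n).π (α g a) * ((hostRep α η n).U g : HostOp α η n)
  rw [← h, mul_assoc, Unitary.star_mul_self_of_mem ((hostRep α η n).U g).2, mul_one]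

end HostProduct

open HostProduct

/-- The C*-algebra generated by all products `π(a) T(l)` in the universal representation. -/
def hostSubalgebra : NonUnitalStarSubalgebra ℂ (HostProduct.{u, v, w} α η) :=
  (NonUnitalStarAlgebra.adjoin ℂ
    {x | ∃ (a : A) (l : L), π α η a * T α η l = x}).topologicalClosure

theorem isClosed_hostSubalgebra :
    IsClosed (hostSubalgebra.{u, v, w} α η : Set (HostProduct.{u, v, w} α η)) :=
  NonUnitalStarSubalgebra.isClosed_topologicalClosure _

/-- The candidate for a full crossed product host. -/
def Host : Type (max u v w) := hostSubalgebra.{u, v, w} α η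

instance : NonUnitalCStarAlgebra (Host.{u, v, w} α η) :=
  @NonUnitalStarSubalgebra.nonUnitalCStarAlgebra _ _ _ _ _ _ _ (hostSubalgebra.{u, v, w} α η)
    (isClosed_hostSubalgebra α η)

variable {α η}

theorem π_mul_T_mem (a : A) (l : L) : π α η a * T α η l ∈ hostSubalgebra.{u, v, w} α η :=
  NonUnitalStarSubalgebra.le_topologicalClosure _
    (NonUnitalStarAlgebra.subset_adjoin ℂ _ ⟨a, l, rfl⟩)

theorem T_mul_π_mem (a : A) (l : L) : T α η l * π α η a ∈ hostSubalgebra.{u, v, w} α η := by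
  have h := star_mem (π_mul_T_mem.{u, v, w} (α := α) (η := η) (star a) (star l))
  rwa [star_mul, ← map_star, ← map_star, star_star, star_star] at h

/-- The adjoints of the generators are the products $T(l)\pi(a)$, so adding these as a second base
case replaces a case for adjoints. -/
theorem hostSubalgebra_induction {P : HostProduct.{u, v, w} α η → Prop}
    (closed : IsClosed {x | P x})
    (π_mul_T : ∀ a l, P (π α η a * T α η l)) (T_mul_π : ∀ a l, P (T α η l * π α η a)) (zero : P 0)
    (add : ∀ x y, P x → P y → P (x + y)) (smul : ∀ (c : ℂ) x, P x → P (c • x))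
    (mul : ∀ x y, y ∈ hostSubalgebra α η → P x → P y → P (x * y))
    {x : HostProduct.{u, v, w} α η} (hx : x ∈ hostSubalgebra α η) : P x := by
  refine closure_minimal (t := {x | P x}) ?_ closed hx
  intro y hy
  have hy' : y ∈ NonUnitalAlgebra.adjoin ℂ
    ({x | ∃ (a : A) (l : L), π α η a * T α η l = x} ∪
      star {x | ∃ (a : A) (l : L), π α η a * T α η l = x}) := hy
  clear hy
  induction hy' using NonUnitalAlgebra.adjoin_induction with
  | mem y hy =>
    rcases hy with ⟨a, l, rfl⟩ | ⟨a, l, h⟩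
    · exact π_mul_T a l
    · rw [← star_star y, ← h, star_mul, ← map_star, ← map_star]
      exact T_mul_π _ _
  | add y z _ _ ihy ihz => exact add y z ihy ihz
  | zero => exact zero
  | mul y z hy hz ihy ihz =>
    exact mul y z (NonUnitalStarSubalgebra.le_topologicalClosure _ hz) ihy ihz
  | smul c y _ ihy => exact smul c y ihy

theorem mul_mem_hostSubalgebra {m : HostProduct.{u, v, w} α η}
    (h1 : ∀ a l, m * (π α η a * T α η l) ∈ hostSubalgebra α η)
    (h2 : ∀ a l, m * (T α η l * π α η a) ∈ hostSubalgebra α η)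
    {x : HostProduct.{u, v, w} α η} (hx : x ∈ hostSubalgebra α η) : m * x ∈ hostSubalgebra α η := by
  refine hostSubalgebra_induction (P := fun x => m * x ∈ hostSubalgebra α η)
    ((isClosed_hostSubalgebra α η).preimage (continuous_const.mul continuous_id)) h1 h2 ?_
    (fun x y hx hy => ?_) (fun c x hx => ?_) (fun x y hy hx _ => ?_) hx
  · rw [mul_zero]; exact zero_mem _
  · rw [mul_add]; exact add_mem hx hy
  · rw [mul_smul_comm]; exact (hostSubalgebra α η).smul_mem c hx
  · rw [← mul_assoc]; exact mul_mem hx hy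

/-- The product $\pi(b)T(l)\pi(a)$ is the limit of $(\pi(b)T(l))(T(e)\pi(a))$ along an approximate
unit of $L$. Thus $\pi(b)$ multiplies the candidate into itself without any convergence assumption.
-/
theorem π_mul_mem (b : A) {x : HostProduct.{u, v, w} α η} (hx : x ∈ hostSubalgebra α η) :
    π α η b * x ∈ hostSubalgebra α η := by
  refine mul_mem_hostSubalgebra (fun a l => ?_) (fun a l => ?_) hx
  · rw [← mul_assoc, ← map_mul]
    exact π_mul_T_mem _ _
  · obtain ⟨F, hF, -⟩ := exists_approximateUnit L
    have := hF.neBot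
    refine (isClosed_hostSubalgebra α η).mem_of_tendsto (b := F)
      (f := fun e => π α η b * (T α η (l * e) * π α η a)) ?_ (Eventually.of_forall fun e => ?_)
    · exact (((continuous_starHom _).continuousAt.tendsto.comp
        (hF.tendsto_mul_left l)).mul_const _).const_mul _
    · rw [map_mul, ← mul_assoc, ← mul_assoc, mul_assoc]
      exact mul_mem (π_mul_T_mem _ _) (T_mul_π_mem _ _)

/-- The mirror image of `π_mul_mem`: here an approximate unit of $A$ splits $T(l')\pi(a)T(l)$ into
two members of the algebra. -/
theorem T_mul_mem (l' : L) {x : HostProduct.{u, v, w} α η} (hx : x ∈ hostSubalgebra α η) :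
    T α η l' * x ∈ hostSubalgebra α η := by
  refine mul_mem_hostSubalgebra (fun a l => ?_) (fun a l => ?_) hx
  · obtain ⟨F, hF, -⟩ := exists_approximateUnit A
    have := hF.neBot
    refine (isClosed_hostSubalgebra α η).mem_of_tendsto (b := F)
      (f := fun e => T α η l' * (π α η (a * e) * T α η l)) ?_ (Eventually.of_forall fun e => ?_)
    · exact (((continuous_starHom _).continuousAt.tendsto.comp
        (hF.tendsto_mul_left a)).mul_const _).const_mul _
    · rw [map_mul, ← mul_assoc, ← mul_assoc, mul_assoc]
      exact mul_mem (T_mul_π_mem _ _) (π_mul_T_mem _ _)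
  · rw [← mul_assoc, ← map_mul]
    exact T_mul_π_mem _ _

theorem U_mul_mem (g : G) {x : HostProduct.{u, v, w} α η} (hx : x ∈ hostSubalgebra α η) :
    U α η g * x ∈ hostSubalgebra α η := by
  refine mul_mem_hostSubalgebra (fun a l => ?_) (fun a l => ?_) hx
  · rw [← mul_assoc, U_mul_π, mul_assoc, U_mul_T]
    exact π_mul_T_mem _ _
  · rw [← mul_assoc, U_mul_T]
    exact T_mul_π_mem _ _

namespace Host

variable (α η)

/-- The inclusion of the host into the product. -/
def incl : Host.{u, v, w} α η →⋆ₙₐ[ℂ] HostProduct.{u, v, w} α η where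
  toFun x := x.1
  map_smul' _ _ := rfl
  map_zero' := rfl
  map_add' _ _ := rfl
  map_mul' _ _ := rfl
  map_star' _ := rfl

theorem incl_injective : Function.Injective (incl.{u, v, w} α η) := fun _ _ h => Subtype.ext h

/-- The homomorphism of `A` into the multipliers of the host. -/
def ηA : A →⋆ₙₐ[ℂ] 𝓜(ℂ, Host.{u, v, w} α η) :=
  multiplierHom (incl α η) (incl_injective α η) (π α η) fun a x => ⟨⟨_, π_mul_mem a x.2⟩, rfl⟩

/-- The homomorphism of `L` into the multipliers of the host. -/
def ηL : L →⋆ₙₐ[ℂ] 𝓜(ℂ, Host.{u, v, w} α η) :=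
  multiplierHom (incl α η) (incl_injective α η) (T α η) fun l x => ⟨⟨_, T_mul_mem l x.2⟩, rfl⟩

/-- The multipliers of the host defined by the elements of the group. -/
def unitaryMultiplier (g : G) : 𝓜(ℂ, Host.{u, v, w} α η) :=
  multiplierOfMul (incl α η) (incl_injective α η) (U α η g) (fun x => ⟨⟨_, U_mul_mem g x.2⟩, rfl⟩)
    (exists_mul_of_star _ fun x => by rw [star_U]; exact ⟨⟨_, U_mul_mem g⁻¹ x.2⟩, rfl⟩)

theorem incl_ηA_fst (a : A) (x : Host.{u, v, w} α η) :
    incl α η ((ηA α η a).fst x) = π α η a * incl α η x :=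
  multiplierHom_fst _ (incl_injective α η) ..

theorem incl_ηL_fst (l : L) (x : Host.{u, v, w} α η) :
    incl α η ((ηL α η l).fst x) = T α η l * incl α η x :=
  multiplierHom_fst _ (incl_injective α η) ..

theorem incl_unitaryMultiplier_fst (g : G) (x : Host.{u, v, w} α η) :
    incl α η ((unitaryMultiplier α η g).fst x) = U α η g * incl α η x :=
  multiplierOfMul_fst _ (incl_injective α η) ..

theorem incl_star_unitaryMultiplier_fst (g : G) (x : Host.{u, v, w} α η) :
    incl α η ((star (unitaryMultiplier α η g)).fst x) = U α η g⁻¹ * incl α η x := by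
  rw [DoubleCentralizer.star_fst, map_star]
  refine (congrArg star (multiplierOfMul_snd ..)).trans ?_
  rw [star_mul, star_U, map_star, star_star]

/-- The element `π(a) T(l)` of the host. -/
def gen (a : A) (l : L) : Host.{u, v, w} α η := ⟨_, π_mul_T_mem a l⟩

theorem coe_gen (a : A) (l : L) :
    (gen.{u, v, w} α η a l : 𝓜(ℂ, Host.{u, v, w} α η)) = ηA α η a * ηL α η l := by
  refine multiplier_ext_fst fun x => incl_injective α η ?_
  refine Eq.trans ?_ (incl_ηA_fst α η a ((ηL α η l).fst x)).symm
  rw [incl_ηL_fst, ← mul_assoc]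
  rfl

theorem eq_gen {a : A} {l : L} {c : Host.{u, v, w} α η}
    (h : (c : 𝓜(ℂ, Host.{u, v, w} α η)) = ηA α η a * ηL α η l) : c = gen α η a l :=
  coe_multiplier_injective (h.trans (coe_gen α η a l).symm)

theorem generates : (NonUnitalStarAlgebra.adjoin ℂ
    {c : Host.{u, v, w} α η | ∃ (a : A) (l : L),
      (c : 𝓜(ℂ, Host.{u, v, w} α η)) = ηA α η a * ηL α η l}).topologicalClosure = ⊤ := by
  set S := (NonUnitalStarAlgebra.adjoin ℂ
    {c : Host.{u, v, w} α η | ∃ (a : A) (l : L),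
      (c : 𝓜(ℂ, Host.{u, v, w} α η)) = ηA α η a * ηL α η l}).topologicalClosure with hS
  have hcl : IsClosed (incl α η '' (S : Set (Host.{u, v, w} α η))) :=
    (NonUnitalStarAlgHom.isometry _ (incl_injective α η)).isClosedEmbedding.isClosedMap _
      (NonUnitalStarSubalgebra.isClosed_topologicalClosure _)
  rw [eq_top_iff]
  rintro x -
  have hx : incl α η x ∈ incl α η '' (S : Set (Host.{u, v, w} α η)) := by
    refine closure_minimal ?_ hcl x.2
    have h : NonUnitalStarAlgebra.adjoin ℂ
        {x : HostProduct.{u, v, w} α η | ∃ (a : A) (l : L), π α η a * T α η l = x} ≤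
          S.map (incl α η) := by
      refine NonUnitalStarAlgebra.adjoin_le ?_
      rintro _ ⟨a, l, rfl⟩
      exact ⟨gen α η a l, NonUnitalStarSubalgebra.le_topologicalClosure _
        (NonUnitalStarAlgebra.subset_adjoin ℂ _ ⟨a, l, coe_gen α η a l⟩), rfl⟩
    exact h
  obtain ⟨y, hy, hxy⟩ := hx
  exact incl_injective α η hxy ▸ hy

variable {α η}

/-- The chosen representative with the norm function of `R` is a component of the product. Norms of
polynomials in the universal family therefore dominate those in `R`, and
`exists_hom_of_norm_lift_le` applies. -/
theorem exists_rep {H : Type w} [NormedAddCommGroup H] [InnerProductSpace ℂ H] [CompleteSpace H]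
    (R : HostCovariantRep α η H) :
    ∃ ρ : Host.{u, v, w} α η →⋆ₙₐ[ℂ] (H →L[ℂ] H), ∀ a l, ρ (gen α η a l) = R.π a * R.T l := by
  let n : hostNorms.{u, v, w} α η :=
    ⟨fun p => ‖FreeNonUnitalNonAssocAlgebra.lift ℂ R.family p‖, ⟨H⟩, R, rfl⟩
  have hn : ∀ p, ‖FreeNonUnitalNonAssocAlgebra.lift ℂ R.family p‖ =
      ‖FreeNonUnitalNonAssocAlgebra.lift ℂ (hostRep α η n).family p‖ :=
    congrFun n.2.choose_spec.choose_spec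
  let x : A ⊕ L → HostProduct.{u, v, w} α η := Sum.elim (π α η) (T α η)
  have hx : ∀ p, compHom n (FreeNonUnitalNonAssocAlgebra.lift ℂ x p) =
      FreeNonUnitalNonAssocAlgebra.lift ℂ (hostRep α η n).family p := by
    intro p
    have := FreeNonUnitalNonAssocAlgebra.hom_ext (R := ℂ)
      (F₁ := ((compHom n : HostProduct.{u, v, w} α η →⋆ₙₐ[ℂ] HostOp α η n) :
        HostProduct.{u, v, w} α η →ₙₐ[ℂ] HostOp α η n).comp
          (FreeNonUnitalNonAssocAlgebra.lift ℂ x))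
      (F₂ := FreeNonUnitalNonAssocAlgebra.lift ℂ (hostRep α η n).family) (by
        intro i
        rw [FreeNonUnitalNonAssocAlgebra.lift_of_apply]
        refine (congrArg (compHom n) (FreeNonUnitalNonAssocAlgebra.lift_of_apply ℂ x i)).trans ?_
        cases i <;> rfl)
    exact DFunLike.congr_fun this p
  obtain ⟨φ, hφ⟩ := exists_hom_of_norm_lift_le (x := x) (y := R.family)
    (σ := Sum.map star star)
    (by rintro (a | l); exacts [(map_star (π α η) a).symm, (map_star (T α η) l).symm])
    (by rintro (a | l); exacts [(map_star R.π a).symm, (map_star R.T l).symm]) (fun p => by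
      rw [hn, ← hx]
      exact NonUnitalStarAlgHom.norm_apply_le (compHom n) _)
  have hmem : ∀ i, x i ∈ (NonUnitalStarAlgebra.adjoin ℂ (Set.range x)).topologicalClosure :=
    fun i => NonUnitalStarSubalgebra.le_topologicalClosure _
      (NonUnitalStarAlgebra.subset_adjoin ℂ _ ⟨i, rfl⟩)
  -- The homomorphism `φ` lives on the larger algebra generated by all $\pi(a)$ and $T(l)$
  -- separately; it is restricted to the candidate.
  have hle : hostSubalgebra.{u, v, w} α η ≤
      (NonUnitalStarAlgebra.adjoin ℂ (Set.range x)).topologicalClosure := by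
    refine NonUnitalStarSubalgebra.topologicalClosure_minimal _ (NonUnitalStarAlgebra.adjoin_le ?_)
      (NonUnitalStarSubalgebra.isClosed_topologicalClosure _)
    rintro _ ⟨a, l, rfl⟩
    exact mul_mem (hmem (Sum.inl a)) (hmem (Sum.inr l))
  refine ⟨φ.comp (NonUnitalStarSubalgebra.inclusion hle), fun a l => ?_⟩
  have h := map_mul φ ⟨_, hmem (Sum.inl a)⟩ ⟨_, hmem (Sum.inr l)⟩
  rw [hφ, hφ] at h
  exact h

theorem tendsto_T_mul {F : Filter L} (hF1 : ∀ᶠ e in F, ‖e‖ ≤ 1) (hF : F.IsApproximateUnit)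
    (hcross : ∀ a l, Tendsto (fun e => T α η e * (π α η a * T α η l)) F
      (𝓝 (π α η a * T α η l : HostProduct.{u, v, w} α η)))
    {x : HostProduct.{u, v, w} α η} (hx : x ∈ hostSubalgebra α η) :
    Tendsto (fun e => T α η e * x) F (𝓝 x) := by
  refine hostSubalgebra_induction (P := fun x => Tendsto (fun e => T α η e * x) F (𝓝 x))
    ?_ hcross (fun a l => ?_) ?_ (fun x y hx hy => ?_) (fun c x hx => ?_) (fun x y _ hx _ => ?_) hx
  · refine isClosed_setOf_tendsto_apply
      (fun e => ContinuousLinearMap.mul ℂ (HostProduct.{u, v, w} α η) (T α η e)) ?_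
    filter_upwards [hF1] with e he x
    refine (norm_mul_le _ _).trans (mul_le_of_le_one_left (norm_nonneg _) ?_)
    exact (NonUnitalStarAlgHom.norm_apply_le _ e).trans he
  · simp only [← mul_assoc, ← map_mul]
    exact ((continuous_starHom (T α η)).continuousAt.tendsto.comp
      (hF.tendsto_mul_right l)).mul_const _
  · simp only [mul_zero]; exact tendsto_const_nhds
  · simp only [mul_add]; exact hx.add hy
  · simp only [mul_smul_comm]; exact hx.const_smul c
  · simp only [← mul_assoc]; exact hx.mul_const y

/-- A full crossed product host exists if `T(e) π(a) T(l) → π(a) T(l)` in norm, uniformly over all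
covariant representations, as `e` runs through an approximate unit of `L`. -/
theorem isFullCrossedProductHost {F : Filter L} (hF1 : ∀ᶠ e in F, ‖e‖ ≤ 1)
    (hF : F.IsApproximateUnit)
    (hcross : ∀ a l, Tendsto (fun e => T α η e * (π α η a * T α η l)) F
      (𝓝 (π α η a * T α η l : HostProduct.{u, v, w} α η))) :
    IsFullCrossedProductHost.{w} α η (ηA.{u, v, w} α η) (ηL.{u, v, w} α η) where
  nondegenerate := by
    have := hF.neBot
    -- This is the only condition that needs the convergence hypothesis: it yields
    -- $c=\lim\eta_L(e)c$.
    intro c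
    refine mem_closure_of_tendsto (b := F) (f := fun e => (ηL α η e).fst c) ?_
      (Eventually.of_forall fun e => Submodule.subset_span ⟨e, c, rfl⟩)
    rw [(NonUnitalStarAlgHom.isometry _
      (incl_injective α η)).isEmbedding.tendsto_nhds_iff]
    simp only [Function.comp_def, incl_ηL_fst]
    exact tendsto_T_mul hF1 hF hcross c.2
  covariant g := by
    refine ⟨unitaryMultiplier α η g, fun l => ?_, fun a => ?_⟩
    · refine multiplier_ext_fst fun x => incl_injective α η ?_
      refine (incl_unitaryMultiplier_fst α η g ((ηL α η l).fst x)).trans ?_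
      rw [incl_ηL_fst, incl_ηL_fst, ← mul_assoc, U_mul_T]
    · refine multiplier_ext_fst fun x => incl_injective α η ?_
      refine (incl_unitaryMultiplier_fst α η g ((ηA α η a).fst
        ((star (unitaryMultiplier α η g)).fst x))).trans ?_
      rw [incl_ηA_fst, incl_ηA_fst, incl_star_unitaryMultiplier_fst, ← mul_assoc, U_mul_π,
        mul_assoc, U_mul_U_inv]
  mul_mem a l := ⟨gen α η a l, coe_gen α η a l⟩
  generates := generates α η
  full H _ _ _ R T hT hU := by
    obtain ⟨ρ, hρ⟩ := exists_rep (⟨R, T, hT, hU⟩ : HostCovariantRep α η H)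
    refine ⟨ρ, fun a l c hc => by rw [eq_gen α η hc]; exact hρ a l, fun ρ' hρ' => ?_⟩
    refine NonUnitalStarAlgHom.ext fun c => ?_
    have hc : c ∈ (⊤ : NonUnitalStarSubalgebra ℂ (Host.{u, v, w} α η)) := trivial
    rw [← generates α η] at hc
    refine closure_minimal (t := {c | ρ' c = ρ c}) ?_
      (isClosed_eq (continuous_starHom ρ') (continuous_starHom ρ)) hc
    have hle : NonUnitalStarAlgebra.adjoin ℂ {c : Host.{u, v, w} α η | ∃ (a : A) (l : L),
        (c : 𝓜(ℂ, Host.{u, v, w} α η)) = ηA α η a * ηL α η l} ≤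
        NonUnitalStarAlgHom.equalizer ρ' ρ := by
      refine NonUnitalStarAlgebra.adjoin_le ?_
      rintro c ⟨a, l, hc⟩
      change ρ' c = ρ c
      rw [hρ' a l c hc, eq_gen α η hc]
      exact (hρ a l).symm
    exact hle

end Host

end ExistenceCriterion

/-! ### Uniform convergence for the dual action, and the theorem. -/

section Cross

/-! ### Consequences of the existence of a host -/

section HostFacts

variable {G : Type*} [Group G] [TopologicalSpace G] {A : Type*} [NonUnitalCStarAlgebra A]
  {α : G →* (A ≃⋆ₐ[ℂ] A)} {L : Type*} [NonUnitalCStarAlgebra L] {η : G →* unitary 𝓜(ℂ, L)}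
  {C : Type*} [NonUnitalCStarAlgebra C] {ηA : A →⋆ₙₐ[ℂ] 𝓜(ℂ, C)} {ηL : L →⋆ₙₐ[ℂ] 𝓜(ℂ, C)}

theorem norm_fst_apply_le_of_norm_le_one {e : L} (he : ‖e‖ ≤ 1) (c : C) : ‖(ηL e).fst c‖ ≤ ‖c‖ := by
  refine ((ηL e).fst.le_opNorm c).trans (mul_le_of_le_one_left (norm_nonneg _) ?_)
  rw [DoubleCentralizer.norm_fst]
  exact (NonUnitalStarAlgHom.norm_apply_le ηL e).trans he

namespace IsFullCrossedProductHost

theorem tendsto_fst (hC : IsFullCrossedProductHost.{w} α η ηA ηL) {F : Filter L}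
    (hF1 : ∀ᶠ e in F, ‖e‖ ≤ 1) (hF : F.IsApproximateUnit) (c : C) :
    Tendsto (fun e => (ηL e).fst c) F (𝓝 c) := by
  have hcl := isClosed_setOf_tendsto_apply (F := F) (fun e => (ηL e).fst)
    (hF1.mono fun e he c => norm_fst_apply_le_of_norm_le_one he c)
  refine closure_minimal ?_ hcl (hC.nondegenerate c)
  intro c hc
  induction hc using Submodule.span_induction with
  | mem c hc =>
    obtain ⟨l, d, rfl⟩ := hc
    have h1 : ∀ e, (ηL e).fst ((ηL l).fst d) = (ηL (e * l)).fst d := fun e => by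
      rw [map_mul]; rfl
    have h2 : Continuous fun m : L => (ηL m).fst d :=
      (continuous_multiplier_fst.comp (continuous_starHom ηL)).clm_apply continuous_const
    simp only [Set.mem_ofPred_eq, h1]
    exact h2.continuousAt.tendsto.comp (hF.tendsto_mul_right l)
  | zero => simpa using tendsto_const_nhds
  | add x y _ _ hx hy =>
    simp only [Set.mem_ofPred_eq, map_add]
    exact Tendsto.add hx hy
  | smul k x _ hx =>
    simp only [Set.mem_ofPred_eq, map_smul]
    exact Tendsto.const_smul hx k

/-- The element `η_A(a) η_L(l)` of a host. -/
def gen (hC : IsFullCrossedProductHost.{w} α η ηA ηL) (a : A) (l : L) : C :=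
  (hC.mul_mem a l).choose

theorem coe_gen (hC : IsFullCrossedProductHost.{w} α η ηA ηL) (a : A) (l : L) :
    (hC.gen a l : 𝓜(ℂ, C)) = ηA a * ηL l := (hC.mul_mem a l).choose_spec

theorem continuous_gen (hC : IsFullCrossedProductHost.{w} α η ηA ηL) :
    Continuous fun p : A × L => hC.gen p.1 p.2 := by
  refine isometry_coe_multiplier.isEmbedding.continuous_iff.2 ?_
  simp only [Function.comp_def, hC.coe_gen]
  exact ((continuous_starHom ηA).comp continuous_fst).mul
    ((continuous_starHom ηL).comp continuous_snd)

theorem gen_zero (hC : IsFullCrossedProductHost.{w} α η ηA ηL) (l : L) : hC.gen 0 l = 0 :=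
  coe_multiplier_injective (by
    rw [hC.coe_gen, map_zero, zero_mul]
    exact (map_zero (DoubleCentralizer.coeHom (𝕜 := ℂ) (A := C))).symm)

/-- Splitting the coefficient as $ab$ writes $\eta_L(l)\eta_A(ab)\eta_L(m)$ as a product of elements
of $C$, namely generators and their adjoints, on which a representation of $C$ is known. -/
theorem fst_gen_mul (hC : IsFullCrossedProductHost.{w} α η ηA ηL) (l : L) (a b : A) (m : L) :
    (ηL l).fst (hC.gen (a * b) m) = star (hC.gen (star a) (star l)) * hC.gen b m := by
  refine coe_multiplier_injective ?_
  rw [coe_fst_apply, hC.coe_gen]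
  have h := map_mul (DoubleCentralizer.coeHom (𝕜 := ℂ) (A := C))
    (star (hC.gen (star a) (star l))) (hC.gen b m)
  rw [map_star] at h
  refine Eq.trans ?_ h.symm
  change _ = star (hC.gen (star a) (star l) : 𝓜(ℂ, C)) * (hC.gen b m : 𝓜(ℂ, C))
  rw [hC.coe_gen, hC.coe_gen, star_mul, ← map_star, ← map_star, star_star, star_star, map_mul]
  simp only [mul_assoc]

/-- The uniqueness clause in the definition of a host does not make `σ` non-degenerate, so no
extension of `σ` to multipliers is used. The identity holds for factored coefficients by
`fst_gen_mul`, and then for all by an approximate unit of $A$. -/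
theorem rep_fst_gen (hC : IsFullCrossedProductHost.{w} α η ηA ηL) {H : Type*}
    [NormedAddCommGroup H] [InnerProductSpace ℂ H] [CompleteSpace H]
    {π : A →⋆ₙₐ[ℂ] (H →L[ℂ] H)} {T : L →⋆ₙₐ[ℂ] (H →L[ℂ] H)} {σ : C →⋆ₙₐ[ℂ] (H →L[ℂ] H)}
    (hσ : ∀ a l, σ (hC.gen a l) = π a * T l) (l : L) (a : A) (m : L) :
    σ ((ηL l).fst (hC.gen a m)) = T l * σ (hC.gen a m) := by
  obtain ⟨E, hE, -⟩ := exists_approximateUnit A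
  have := hE.neBot
  have h1 : Continuous fun a => σ ((ηL l).fst (hC.gen a m)) :=
    (continuous_starHom σ).comp ((ηL l).fst.continuous.comp
      (hC.continuous_gen.comp (by fun_prop : Continuous fun a : A => (a, m))))
  have h2 : Continuous fun a => T l * σ (hC.gen a m) :=
    continuous_const.mul ((continuous_starHom σ).comp
      (hC.continuous_gen.comp (by fun_prop : Continuous fun a : A => (a, m))))
  refine tendsto_nhds_unique (h1.continuousAt.tendsto.comp (hE.tendsto_mul_left a))
    ((h2.continuousAt.tendsto.comp (hE.tendsto_mul_left a)).congr fun b => ?_)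
  simp only [Function.comp_def]
  rw [hC.fst_gen_mul, map_mul, map_star, hσ, hσ, hσ, star_mul, map_mul, map_star, map_star,
    star_star, star_star]
  simp only [mul_assoc]

end IsFullCrossedProductHost

/-- Strong convergence of contractions is uniform on compact sets: the range of `c` is compact and
has a finite $\varepsilon/3$-net. -/
theorem eventually_forall_norm_apply_sub_le {X Y E : Type*} [TopologicalSpace Y]
    [NormedAddCommGroup E] [NormedSpace ℂ E] {F : Filter X} (V : X → E →L[ℂ] E)
    (hV : ∀ᶠ e in F, ∀ x, ‖V e x‖ ≤ ‖x‖) (hlim : ∀ x, Tendsto (fun e => V e x) F (𝓝 x))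
    {c : Y → E} (hc : Continuous c) (hs : HasCompactSupport c) {ε : ℝ} (hε : 0 < ε) :
    ∀ᶠ e in F, ∀ y, ‖V e (c y) - c y‖ ≤ ε := by
  obtain ⟨t, -, htf, ht⟩ := (hs.isCompact_range hc).finite_cover_balls
    (show 0 < ε / 3 by positivity)
  have h : ∀ᶠ e in F, ∀ x ∈ t, dist (V e x) x < ε / 3 :=
    (htf.eventually_all).2 fun x _ => Metric.tendsto_nhds.1 (hlim x) _ (by positivity)
  filter_upwards [hV, h] with e he het y
  obtain ⟨x, hx, hxy⟩ := Set.mem_iUnion₂.1 (ht ⟨y, rfl⟩)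
  have h1 : dist (V e (c y)) (V e x) ≤ dist (c y) x := by
    rw [dist_eq_norm, dist_eq_norm, ← map_sub]
    exact he _
  have h2 := het x hx
  rw [Metric.mem_ball] at hxy
  rw [← dist_eq_norm]
  linarith [dist_triangle4 (V e (c y)) (V e x) x (c y), dist_comm (c y) x]

end HostFacts

/-! ### Covariant representations of the dual action -/

variable {G : Type u} [CommGroup G] [TopologicalSpace G] [IsTopologicalGroup G]
  [LocallyCompactSpace G] {A : Type v} [NonUnitalCStarAlgebra A] {α : G →* (A ≃⋆ₐ[ℂ] A)}

theorem dualAction_coeffMultiplier (g : G) (a : A) (x : DualCrossedProduct G A) :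
    dualAction α g ((coeffMultiplier (PontryaginDual G) A a).fst x) =
      (coeffMultiplier (PontryaginDual G) A (α g a)).fst (dualAction α g x) := by
  refine CrossedProduct.incl_injective ?_
  refine Eq.trans ?_ (coeffMultiplier_fst _ _).symm
  refine (congrArg (twistProduct (evalCharacter g) (α g)) (coeffMultiplier_fst a x)).trans ?_
  rw [map_mul]
  rfl

/-- The twisting homomorphism is defined on the whole universal product, which contains the
unitaries of $\hat G$, and it multiplies the unitary of $\gamma$ by $\gamma(g)$. -/
theorem dualAction_translationMultiplier (g : G) (γ : PontryaginDual G)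
    (x : DualCrossedProduct G A) :
    dualAction α g ((translationMultiplier γ).fst x) =
      (γ g : ℂ) • (translationMultiplier γ).fst (dualAction α g x) := by
  refine CrossedProduct.incl_injective ?_
  rw [map_smul]
  refine (map_mul (twistProduct (evalCharacter g) (α g)) (universalUnitary A γ) x.1).trans ?_
  refine Eq.trans ?_ (smul_mul_assoc (γ g : ℂ) (universalUnitary A γ) _)
  rfl

variable {H : Type w} [NormedAddCommGroup H] [InnerProductSpace ℂ H] [CompleteSpace H]

namespace CovariantRep

theorem U_mul_rep (R : CovariantRep (dualAction α) H) (g : G) (x : DualCrossedProduct G A) :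
    (R.U g : H →L[ℂ] H) * R.π x = R.π (dualAction α g x) * (R.U g : H →L[ℂ] H) := by
  rw [← R.covariant, mul_assoc, Unitary.star_mul_self_of_mem (R.U g).2, mul_one]

/-- The Weyl commutation relation between $G$ and $\hat G$: it expresses that $\beta_g$ scales the
multiplier of $\gamma$ by $\gamma(g)$. -/
theorem U_mul_dual_U (R : CovariantRep (dualAction α) H) (g : G) (γ : PontryaginDual G) :
    (R.U g : H →L[ℂ] H) * (R.nondegenerate.covariantRep.U γ : H →L[ℂ] H) =
      (γ g : ℂ) • ((R.nondegenerate.covariantRep.U γ : H →L[ℂ] H) * (R.U g : H →L[ℂ] H)) := by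
  refine R.nondegenerate.ext_mul fun x => ?_
  rw [mul_assoc, R.nondegenerate.covariantRep_U, R.nondegenerate.extension_mul, U_mul_rep,
    dualAction_translationMultiplier, map_smul, ← R.nondegenerate.extension_mul, smul_mul_assoc,
    smul_mul_assoc, mul_assoc, mul_assoc, U_mul_rep]

/-- The covariant representation of `(A, G, α)` defined by a covariant representation of
`(A ⋊ Ĝ, G, β)`. -/
def ofDual (R : CovariantRep (dualAction α) H) : CovariantRep α H where
  π := R.nondegenerate.covariantRep.π
  U := R.U
  nondegenerate := R.nondegenerate.covariantRep.nondegenerate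
  continuous_U := R.continuous_U
  covariant g a := by
    have h : (R.U g : H →L[ℂ] H) * R.nondegenerate.covariantRep.π a =
        R.nondegenerate.covariantRep.π (α g a) * (R.U g : H →L[ℂ] H) := by
      refine R.nondegenerate.ext_mul fun x => ?_
      rw [mul_assoc, R.nondegenerate.covariantRep_π, R.nondegenerate.covariantRep_π,
        R.nondegenerate.extension_mul, U_mul_rep, dualAction_coeffMultiplier,
        ← R.nondegenerate.extension_mul, mul_assoc, mul_assoc, U_mul_rep]
    rw [h, mul_assoc, Unitary.mul_star_self_of_mem (R.U g).2, mul_one]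

end CovariantRep

/-- Apply the Weyl relation under the integral $T(f)=\int f(g)U_g\,dg$. Moving $V_\gamma$ to the
right of $T$ costs only a modulation of $f$ by $\gamma^{-1}$. -/
theorem HostCovariantRep.dual_U_apply_T (R : HostCovariantRep (dualAction α) (groupUnitary G) H)
    (γ : PontryaginDual G) (f : C_c(G, ℂ)) (ξ : H) :
    (R.nondegenerate.covariantRep.U γ : H →L[ℂ] H) (R.T (CrossedProduct.of f) ξ) =
      R.T (CrossedProduct.of (twistFun γ⁻¹ 1 f))
        ((R.nondegenerate.covariantRep.U γ : H →L[ℂ] H) ξ) := by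
  let _ : MeasurableSpace G := borel G
  have h := fun (f : C_c(G, ℂ)) (ξ : H) =>
    groupRep_of_apply R.nondegenerate_T R.isExtensionValue_U f ξ
  rw [(h f ξ).2, (h _ _).2, ← ContinuousLinearMap.integral_comp_comm _ (h f ξ).1]
  refine MeasureTheory.integral_congr_ae (Eventually.of_forall fun g => ?_)
  have h1 := congrArg (fun t : H →L[ℂ] H => t ξ) (R.toCovariantRep.U_mul_dual_U g γ)
  simp only [mul_apply_eq_comp, smul_apply] at h1
  change (R.nondegenerate.covariantRep.U γ : H →L[ℂ] H) (f g • (R.U g : H →L[ℂ] H) ξ) =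
    ((((γ g)⁻¹ : Circle) : ℂ) * f g) • (R.U g : H →L[ℂ] H) _
  rw [h1, map_smul, smul_smul, mul_right_comm, ← Circle.coe_mul, inv_mul_cancel, Circle.coe_one,
    one_mul]

/-- All modulations of $f$ are supported in $\operatorname{supp}f$, and the pairing $\hat G\times
G\to\mathbb T$ is jointly continuous because $G$ is locally compact. -/
theorem continuous_of_twistFun (f : C_c(G, ℂ)) : Continuous fun γ : PontryaginDual G =>
    (CrossedProduct.of (twistFun γ⁻¹ 1 f) : GroupCStarAlgebra G) := by
  refine CrossedProduct.continuous_of ?_ fun γ =>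
    ⟨Set.univ, univ_mem, tsupport f, f.hasCompactSupport, fun χ _ g hg => ?_⟩
  · have h1 : Continuous fun p : PontryaginDual G × G => p.1 p.2 := by
      have h2 : Continuous fun p : (G →ₜ* Circle) × G => p.1.toContinuousMap p.2 :=
        continuous_eval.comp
          ((ContinuousMonoidHom.isInducing_toContinuousMap G Circle).continuous.prodMap
            continuous_id)
      exact h2
    have h3 : Continuous fun p : PontryaginDual G × G => ((p.1⁻¹ : PontryaginDual G) p.2 : ℂ) :=
      continuous_subtype_val.comp (h1.comp (continuous_fst.inv.prodMk continuous_snd))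
    exact h3.smul (f.continuous.comp continuous_snd)
  · change ((χ⁻¹ : PontryaginDual G) g : ℂ) • f g = 0
    rw [image_eq_zero_of_notMem_tsupport hg, smul_zero]

variable {C : Type*} [NonUnitalCStarAlgebra C] {ηA : A →⋆ₙₐ[ℂ] 𝓜(ℂ, C)}
  {ηL : GroupCStarAlgebra G →⋆ₙₐ[ℂ] 𝓜(ℂ, C)}

/-- The estimate behind the theorem: `ρ(F) T(f) = ∫ π(F(γ)) T(γ⁻¹ f) V(γ) dγ` is almost invariant
under multiplication by `T(e)`, uniformly over all covariant representations. -/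
theorem eventually_norm_T_mul_sub_le
    (hC : IsFullCrossedProductHost.{w} α (groupUnitary G) ηA ηL)
    {F : Filter (GroupCStarAlgebra G)} (hF1 : ∀ᶠ e in F, ‖e‖ ≤ 1) (hF : F.IsApproximateUnit)
    (φ : C_c(PontryaginDual G, A)) (f : C_c(G, ℂ)) {ε : ℝ} (hε : 0 < ε) :
    ∀ᶠ e in F, ∀ (H : HilbertSpace.{w})
      (R : HostCovariantRep (dualAction α) (groupUnitary G) H.carrier),
        ‖R.T e * (R.π (CrossedProduct.of φ) * R.T (CrossedProduct.of f)) -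
          R.π (CrossedProduct.of φ) * R.T (CrossedProduct.of f)‖ ≤ ε := by
  let _ : MeasurableSpace (PontryaginDual G) := borel _
  have _ : BorelSpace (PontryaginDual G) := ⟨rfl⟩
  -- This function takes values in the given host and is fixed before any representation is chosen;
  -- that is the source of the uniformity.
  let c : PontryaginDual G → C := fun γ => hC.gen (φ γ) (CrossedProduct.of (twistFun γ⁻¹ 1 f))
  have hc : Continuous c :=
    hC.continuous_gen.comp (φ.continuous.prodMk (continuous_of_twistFun f))
  have hcz : ∀ γ ∉ tsupport φ, c γ = 0 := fun γ hγ => by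
    simp only [c]
    rw [image_eq_zero_of_notMem_tsupport hγ, hC.gen_zero]
  have hs : HasCompactSupport c := HasCompactSupport.intro' φ.hasCompactSupport
    (isClosed_tsupport φ) hcz
  have hμ : haarMeasure (PontryaginDual G) (tsupport φ) < ∞ :=
    IsCompact.measure_lt_top (μ := MeasureTheory.Measure.haar) φ.hasCompactSupport
  set M := (haarMeasure (PontryaginDual G)).real (tsupport φ)
  have hM : 0 ≤ M := MeasureTheory.measureReal_nonneg
  filter_upwards [eventually_forall_norm_apply_sub_le (fun e => (ηL e).fst)
    (hF1.mono fun e he x => norm_fst_apply_le_of_norm_le_one he x) (hC.tendsto_fst hF1 hF) hc hs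
    -- The error is integrated over $\operatorname{supp}\varphi$, of Haar measure `M`; adding 1
    -- keeps the quotient defined when `M = 0`.
    (ε := ε / (M + 1)) (by positivity)] with e he H R
  obtain ⟨σ, hσ, -⟩ := hC.full H.carrier R.toCovariantRep.ofDual R.T R.nondegenerate_T
    R.isExtensionValue_U
  have hσ' : ∀ a l, σ (hC.gen a l) = R.nondegenerate.covariantRep.π a * R.T l :=
    fun a l => hσ a l _ (hC.coe_gen a l)
  set V : PontryaginDual G → H.carrier →L[ℂ] H.carrier :=
    fun γ => R.nondegenerate.covariantRep.U γ with hV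
  -- Disintegrate $\pi(\varphi)$ and move each $V_\gamma$ past $T(f)$: the coefficient that remains
  -- is $\pi_A(\varphi(\gamma))T(\gamma^{-1}f)=\sigma(c(\gamma))$.
  have hint : ∀ ξ, R.π (CrossedProduct.of φ) (R.T (CrossedProduct.of f) ξ) =
      ∫ γ, σ (c γ) (V γ ξ) ∂(haarMeasure (PontryaginDual G)) := by
    intro ξ
    rw [← R.nondegenerate.integratedForm_covariantRep, CovariantRep.integratedForm_apply]
    refine MeasureTheory.integral_congr_ae (Eventually.of_forall fun γ => ?_)
    beta_reduce
    rw [R.dual_U_apply_T, hσ']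
    rfl
  have hintegrable : ∀ ξ, MeasureTheory.Integrable (fun γ => σ (c γ) (V γ ξ))
      (haarMeasure (PontryaginDual G)) := by
    intro ξ
    refine integrable_haarMeasure (((continuous_starHom σ).comp hc).clm_apply
      (R.nondegenerate.covariantRep.continuous_U ξ)) (hs.mono fun γ hγ hcγ => hγ ?_)
    simp [hcγ]
  refine ContinuousLinearMap.opNorm_le_bound _ hε.le fun ξ => ?_
  rw [sub_apply, mul_apply_eq_comp, mul_apply_eq_comp, hint]
  rw [← ContinuousLinearMap.integral_comp_comm _ (hintegrable ξ),
    ← MeasureTheory.integral_sub ((R.T e).integrable_comp (hintegrable ξ)) (hintegrable ξ)]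
  have hdiff : ∀ γ, R.T e (σ (c γ) (V γ ξ)) - σ (c γ) (V γ ξ) =
      σ ((ηL e).fst (c γ) - c γ) (V γ ξ) := by
    intro γ
    rw [map_sub, sub_apply, hC.rep_fst_gen hσ']
    rfl
  simp only [hdiff]
  rw [← MeasureTheory.setIntegral_eq_integral_of_forall_compl_eq_zero (s := tsupport φ)
    (fun γ hγ => by simp [hcz γ hγ])]
  refine (MeasureTheory.norm_setIntegral_le_of_norm_le_const (C := ε / (M + 1) * ‖ξ‖) hμ
    fun γ _ => ?_).trans ?_
  · refine (ContinuousLinearMap.le_opNorm _ _).trans ?_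
    rw [hV, Unitary.norm_map]
    gcongr
    exact (NonUnitalStarAlgHom.norm_apply_le σ _).trans (he γ)
  · change ε / (M + 1) * ‖ξ‖ * M ≤ ε * ‖ξ‖
    have h1 : ε / (M + 1) * M ≤ ε := by
      rw [div_mul_eq_mul_div, div_le_iff₀ (by positivity)]
      nlinarith
    calc ε / (M + 1) * ‖ξ‖ * M = ε / (M + 1) * M * ‖ξ‖ := by ring
      _ ≤ ε * ‖ξ‖ := by gcongr

theorem tendsto_T_mul_π_mul_T (hC : IsFullCrossedProductHost.{w} α (groupUnitary G) ηA ηL)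
    {F : Filter (GroupCStarAlgebra G)} (hF1 : ∀ᶠ e in F, ‖e‖ ≤ 1) (hF : F.IsApproximateUnit)
    (x : DualCrossedProduct G A) (l : GroupCStarAlgebra G) :
    Tendsto (fun e => HostProduct.T (dualAction α) (groupUnitary G) e *
      (HostProduct.π (dualAction α) (groupUnitary G) x *
        HostProduct.T (dualAction α) (groupUnitary G) l)) F
      (𝓝 (HostProduct.π (dualAction α) (groupUnitary G) x *
        HostProduct.T.{max u v, u, w} (dualAction α) (groupUnitary G) l)) := by
  set T := HostProduct.T.{max u v, u, w} (dualAction α) (groupUnitary G)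
  set π := HostProduct.π.{max u v, u, w} (dualAction α) (groupUnitary G)
  have hneBot := hF.neBot
  have hcl : IsClosed {z | Tendsto (fun e => T e * z) F (𝓝 z)} := by
    refine isClosed_setOf_tendsto_apply (fun e => ContinuousLinearMap.mul ℂ
      (HostProduct.{max u v, u, w} (dualAction α) (groupUnitary G)) (T e)) ?_
    filter_upwards [hF1] with e he z
    refine (norm_mul_le _ _).trans (mul_le_of_le_one_left (norm_nonneg _) ?_)
    exact (NonUnitalStarAlgHom.norm_apply_le _ e).trans he
  have hmul : ∀ z y, Tendsto (fun e => T e * z) F (𝓝 z) →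
      Tendsto (fun e => T e * (z * y)) F (𝓝 (z * y)) := fun z y hz => by
    simp only [← mul_assoc]
    exact hz.mul_const y
  have hadd : ∀ z y, Tendsto (fun e => T e * z) F (𝓝 z) → Tendsto (fun e => T e * y) F (𝓝 y) →
      Tendsto (fun e => T e * (z + y)) F (𝓝 (z + y)) := fun z y hz hy => by
    simp only [mul_add]
    exact hz.add hy
  have hsmul : ∀ (k : ℂ) z, Tendsto (fun e => T e * z) F (𝓝 z) →
      Tendsto (fun e => T e * (k • z)) F (𝓝 (k • z)) := fun k z hz => by
    simp only [mul_smul_comm]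
    exact hz.const_smul k
  have hzero : Tendsto (fun e => T e * 0) F (𝓝 0) := by
    simp only [mul_zero]
    exact tendsto_const_nhds
  induction x using CrossedProduct.induction generalizing l with
  | closed =>
    simp only [Set.ofPred_forall]
    exact isClosed_iInter fun l =>
      hcl.preimage ((continuous_starHom π).mul (continuous_const (y := T l)))
  | of φ =>
    induction l using CrossedProduct.induction with
    | closed => exact hcl.preimage (continuous_const.mul (continuous_starHom T))
    | of f =>
      refine Metric.tendsto_nhds.2 fun ε hε => ?_
      filter_upwards [eventually_norm_T_mul_sub_le hC hF1 hF φ f (half_pos hε)] with e he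
      rw [dist_eq_norm]
      refine (HostProduct.norm_le_of_forall (half_pos hε).le fun n => ?_).trans_lt
        (half_lt_self hε)
      exact he _ (hostRep _ _ n)
    | zero => rw [map_zero, mul_zero]; exact hzero
    | add l m hl hm => rw [map_add, mul_add]; exact hadd _ _ hl hm
    | smul k l hl => rw [map_smul, mul_smul_comm]; exact hsmul k _ hl
    | mul l m hl _ => rw [map_mul, ← mul_assoc]; exact hmul _ _ hl
  | zero => rw [map_zero, zero_mul]; exact hzero
  | add x y hx hy => rw [map_add, add_mul]; exact hadd _ _ (hx l) (hy l)
  | smul k x hx => rw [map_smul, smul_mul_assoc]; exact hsmul k _ (hx l)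
  | mul x y hx hy =>
    rw [map_mul, mul_assoc]
    -- The convergence for `y` gives $\pi(x)\pi(y)T(l)=\lim\pi(x)T(e)\pi(y)T(l)$, and each
    -- approximant begins with $\pi(x)T(e)$, for which convergence is known. Hence the induction on
    -- `x` must hold for all `l` at once.
    refine hcl.mem_of_tendsto (b := F) ((hy l).const_mul (π x)) (Eventually.of_forall fun e => ?_)
    rw [← mul_assoc]
    exact hmul _ _ (hx e)

end Cross

end CStarAction

end

theorem mainTheorem9 {G : Type u} [CommGroup G] [TopologicalSpace G] [IsTopologicalGroup G]
    [LocallyCompactSpace G] [T2Space G] {A : Type v} [NonUnitalCStarAlgebra A]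
    (α : G →* (A ≃⋆ₐ[ℂ] A)) (h : CStarAction.HasFullCrossedProductHost α) :
    CStarAction.HasFullCrossedProductHost (CStarAction.dualAction α) := by
  obtain ⟨C, _, ηA, ηL, hC⟩ := h
  obtain ⟨F, hF, hF1⟩ := CStarAction.exists_approximateUnit (CStarAction.GroupCStarAlgebra G)
  exact ⟨CStarAction.Host.{max u v, u, max u v} (CStarAction.dualAction α)
    (CStarAction.groupUnitary G), inferInstance, _, _,
    CStarAction.Host.isFullCrossedProductHost hF1 hF
      (CStarAction.tendsto_T_mul_π_mul_T hC hF1 hF)⟩
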